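/- Let $n\ge 1$, let $d_1,\dots,d_n\ge 1$ be integers and let $\gamma_1,\dots,\gamma_n\in\mathbb C$ satisfy $\Re\gamma_j>0$ for all $j$. For $\mathbf s=(s_1,\dots,s_n)\in\mathbb C^n$ with $\Re(s_j+\dots+s_n)>\frac1{d_j}+\dots+\frac1{d_n}$ for all $1\le j\le n$, let $\zeta_{n,\mathbf d,\boldsymbol\gamma}(\mathbf s)$ be the absolutely convergent series $$\zeta_{n,\mathbf d,\boldsymbol\gamma}(\mathbf s)=\sum_{m_1,\dots,m_n\ge 1}\ \prod_{j=1}^n\bigl(\gamma_1m_1^{d_1}+\dots+\gamma_jm_j^{d_j}\bigr)^{-s_j}$$ (principal branches). Assume that for all $1\le j\le n$ and all $\varepsilon_{j+1},\dots,\varepsilon_n\in\{0,1\}$ the number $\frac1{d_j}+\sum_{k=j+1}^n\frac{\varepsilon_k}{d_k}$ is not a positive integer. Then $\zeta_{n,\mathbf d,\boldsymbol\gamma}$ has a meromorphic continuation to $\mathbb C^n$, denoted by the same symbol, and, writing $|\mathbf N|=N_1+\dots+N_n$ and letting $B_k$ be the Bernoulli numbers defined by $\frac{X}{e^X-1}=\sum_{k\ge0}\frac{B_k}{k!}X^k$: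 1. For every $\mathbf N=(N_1,\dots,N_n)\in\mathbb Z_{\ge0}^n$, the point $-\mathbf N$ is a regular point of $\zeta_{n,\mathbf d,\boldsymbol\gamma}$ (the continuation is holomorphic there), and $\zeta_{n,\mathbf d,\boldsymbol\gamma}(-\mathbf N)\in\mathbb Q(\gamma_1,\dots,\gamma_n)$. 2. If $d_2,\dots,d_n$ are even, then for every $\mathbf N\in\mathbb Z_{\ge0}^n$ $$\zeta_{n,\mathbf d,\boldsymbol\gamma}(-\mathbf N)=\Bigl(-\frac12\Bigr)^{n-1}\gamma_1^{|\mathbf N|}(-1)^{d_1|\mathbf N|}\,\frac{B_{d_1|\mathbf N|+1}}{d_1|\mathbf N|+1}.$$ 3. In particular, if $d_1,\dots,d_n$ are all even, then $\zeta_{n,\mathbf d,\boldsymbol\gamma}(0,\dots,0)=\bigl(-\frac12\bigr)^n$, and $\zeta_{n,\mathbf d,\boldsymbol\gamma}(-\mathbf N)=0$ for every $\mathbf N\in\mathbb Z_{\ge0}^n\setminus\{\mathbf 0\}$. -/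

import Mathlib

open Filter Topology

noncomputable section

/-- The summand `1 / ∏ⱼ (γ₁ m₁^{d₁} + ⋯ + γⱼ mⱼ^{dⱼ})^{sⱼ}` indexed by an `n`-tuple `m` of positive
integers. The complex powers use the principal branch; every base has positive real part as soon as
all the `γⱼ` have positive real part. -/
def multiZetaTerm {n : ℕ} (d : Fin n → ℕ) (γ : Fin n → ℂ) (s : Fin n → ℂ) (m : Fin n → ℕ+) : ℂ :=
  1 / ∏ j : Fin n, (∑ i ∈ Finset.Iic j, γ i * ((m i : ℕ) : ℂ) ^ d i) ^ s j

/-- The domain of absolute convergence of the series: all `s` with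
`Re (sⱼ + ⋯ + sₙ) > 1/dⱼ + ⋯ + 1/dₙ` for every `j`. -/
def convergenceDomain {n : ℕ} (d : Fin n → ℕ) : Set (Fin n → ℂ) :=
  {s | ∀ j : Fin n, ∑ k ∈ Finset.Ici j, (1 : ℝ) / d k < (∑ k ∈ Finset.Ici j, s k).re}

/-- A function on `ℂⁿ` is meromorphic if near every point it is a quotient `g / h` of holomorphic
functions whose denominator `h` does not vanish identically near that point. No condition is put on
the values on the zero set of `h`. -/
def IsMeromorphicOnSpace {n : ℕ} (F : (Fin n → ℂ) → ℂ) : Prop :=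
  ∀ p : Fin n → ℂ, ∃ g h : (Fin n → ℂ) → ℂ,
    AnalyticAt ℂ g p ∧ AnalyticAt ℂ h p ∧ (∃ᶠ s in 𝓝 p, h s ≠ 0) ∧
      ∀ᶠ s in 𝓝 p, h s ≠ 0 → F s = g s / h s

/-- `Z` is the meromorphic continuation to `ℂⁿ` of the multiple zeta series: it is meromorphic on
`ℂⁿ`, and throughout the domain of convergence the series is summable with sum `Z s`. -/
structure IsMultiZetaContinuation {n : ℕ} (d : Fin n → ℕ) (γ : Fin n → ℂ)
    (Z : (Fin n → ℂ) → ℂ) : Prop where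
  meromorphic : IsMeromorphicOnSpace Z
  hasSum : ∀ s ∈ convergenceDomain d, HasSum (multiZetaTerm d γ s) (Z s)

/-- For all `j` and all `ε_{j+1}, …, ε_n ∈ {0, 1}`, the number `1/dⱼ + ∑_{k > j} ε_k / d_k` is not a
positive integer. -/
def NonIntegralSums {n : ℕ} (d : Fin n → ℕ) : Prop :=
  ∀ (j : Fin n) (ε : Fin n → Fin 2) (m : ℕ), 1 ≤ m →
    (1 : ℚ) / d j + ∑ k ∈ Finset.Ioi j, ((ε k : ℕ) : ℚ) / d k ≠ m

end

/-! The proof is an induction on the number of variables, integrating out the last one. For a single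
variable the function is `γ^(-s) ζ(ds)`.

For the step, write `a` for the partial sum of the earlier terms and `c`, `d`, `s` for the last
coefficient, degree and exponent. Euler's integral gives `Σ_m (a + c m^d)^(-s) = Γ(s)⁻¹ ∫ t^(s-1)
e^(-ta) θ(t) dt` with `θ(t) = Σ_m exp(-c m^d t)`. Euler–Maclaurin (`exists_norm_thetaRemainder_le`)
gives `θ(t) = C t^(-1/d) + Σ_{k<K} ζ(-dk) (-c)^k/k! t^k + O(t^K)` for all `t > 0`. Each explicit
term integrates to a Gamma factor times a power of `a`, and this power merges with the preceding
exponent (`multiZetaTerm_tailShift`), so the already continued function of one variable fewer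
appears at a shifted point. The remainder, summed over the earlier variables, is one absolutely
convergent integral, holomorphic on a region which exhausts the whole space as `K` grows
(`analyticAt_remainderIntegral`).

At `s = -N` the factor `1/Γ(s)` kills both the `t^(-1/d)` term and the remainder, so the
transcendental constant `C` never enters, and the Pochhammer factors cut the sum at `k ≤ N`
(`lastContinuation_neg_natCast`). What is left is a rational recursion. If `d` is even then `ζ(-dk)
= 0` for `k ≥ 1`, so each step contributes only the factor `ζ(0) = -1/2`. The hypothesis on the sums
of reciprocals keeps the points `-N` off the possible polar hyperplanes (`regularSet`). -/

/-! ### Holomorphy of Laplace-type integrals; Euler's integral with a complex parameter. -/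

open MeasureTheory in
/-- A Laplace-type integral `∫ w · exp (Σ sᵢ ℓᵢ)` is analytic at every interior point of its domain
of absolute convergence. -/
theorem analyticAt_integral_exp_of_integrable {Ω ι : Type*} [MeasurableSpace Ω] [Fintype ι]
    {μ : Measure Ω} {w : Ω → ℂ} {l : Ω → ι → ℂ} (hw : AEStronglyMeasurable w μ)
    (hl : ∀ i, AEStronglyMeasurable (fun ω => l ω i) μ) {p : ι → ℂ} {r : ℝ} (hr : 0 < r)
    (hint : Integrable (fun ω => ‖w ω * Complex.exp (∑ i, p i * l ω i)‖ *
      Real.exp (r * ∑ i, ‖l ω i‖)) μ) :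
    AnalyticAt ℂ (fun s : ι → ℂ => ∫ ω, w ω * Complex.exp (∑ i, s i * l ω i) ∂μ) p := by
  classical
  set v : Ω → ℂ := fun ω => w ω * Complex.exp (∑ i, p i * l ω i) with hv
  have hvm : AEStronglyMeasurable v μ := by
    refine hw.mul (Complex.continuous_exp.comp_aestronglyMeasurable ?_)
    exact Finset.aestronglyMeasurable_fun_sum _ fun i _ => (hl i).const_mul _
  let L : Ω → (ι → ℂ) →L[ℂ] ℂ := fun ω => ∑ i, l ω i • ContinuousLinearMap.proj i
  have hLa : ∀ ω y, L ω y = ∑ i, y i * l ω i := fun ω y => by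
    simp [L, mul_comm]
  have hLm : AEStronglyMeasurable L μ :=
    Finset.aestronglyMeasurable_fun_sum _ fun i _ => (hl i).smul_const _
  have hLn : ∀ ω, ‖L ω‖ ≤ ∑ i, ‖l ω i‖ := fun ω => by
    refine ContinuousLinearMap.opNorm_le_bound _ (Finset.sum_nonneg fun _ _ => norm_nonneg _) ?_
    intro y
    rw [hLa, Finset.sum_mul]
    refine (norm_sum_le _ _).trans (Finset.sum_le_sum fun i _ => ?_)
    rw [norm_mul, mul_comm]
    gcongr
    exact norm_le_pi_norm y i
  let T : (k : ℕ) → ((ι → ℂ) →L[ℂ] ℂ) → ContinuousMultilinearMap ℂ (fun _ : Fin k => ι → ℂ) ℂ :=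
    fun k A => (ContinuousMultilinearMap.mkPiAlgebraFin ℂ k ℂ).compContinuousLinearMap fun _ => A
  have hTc : ∀ k, Continuous (T k) := fun k => by
    have := (ContinuousMultilinearMap.compContinuousLinearMapContinuousMultilinear ℂ
      (fun _ : Fin k => ι → ℂ) (fun _ : Fin k => ℂ) ℂ).cont
    exact (ContinuousLinearMap.apply ℂ _ (ContinuousMultilinearMap.mkPiAlgebraFin ℂ k ℂ)).continuous.comp
      (this.comp (continuous_pi fun _ => continuous_id))
  have hTn : ∀ k A, ‖T k A‖ ≤ ‖A‖ ^ k := fun k A => by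
    refine (ContinuousMultilinearMap.norm_compContinuousLinearMap_le _ _).trans ?_
    simp
  have hTa : ∀ k A y, T k A (fun _ => y) = A y ^ k := fun k A y => by
    simp [T]
  -- This trades a `k`-th power of the exponents, divided by `k!`, for the exponential weight in
  -- `hint`, at the cost of `r ^ (-k)`.
  have hfac : ∀ (k : ℕ) (x : ℝ), 0 ≤ x → x ^ k / k.factorial ≤ Real.exp x := fun k x hx =>
    Real.pow_div_factorial_le_exp x hx k
  have hgi : ∀ k, Integrable (fun ω => (v ω * (k.factorial : ℂ)⁻¹) • T k (L ω)) μ := fun k => by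
    refine Integrable.mono' (hint.mul_const ((r ^ k)⁻¹)) ?_ ?_
    · exact (hvm.mul_const _).smul ((hTc k).comp_aestronglyMeasurable hLm)
    · refine Eventually.of_forall fun ω => ?_
      rw [norm_smul, norm_mul, norm_inv, Complex.norm_natCast, mul_assoc, mul_assoc]
      refine mul_le_mul_of_nonneg_left ?_ (norm_nonneg _)
      have h1 := hfac k (r * ∑ i, ‖l ω i‖) (by positivity)
      have h2 : ‖T k (L ω)‖ ≤ (∑ i, ‖l ω i‖) ^ k :=
        (hTn k _).trans (pow_le_pow_left₀ (norm_nonneg _) (hLn ω) k)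
      calc (k.factorial : ℝ)⁻¹ * ‖T k (L ω)‖ ≤ (k.factorial : ℝ)⁻¹ * (∑ i, ‖l ω i‖) ^ k := by gcongr
        _ = (r * ∑ i, ‖l ω i‖) ^ k / k.factorial * (r ^ k)⁻¹ := by
          rw [mul_pow]; field_simp
        _ ≤ _ := by gcongr
  -- Taylor coefficients at `p`, from expanding the exponential of `L ω y` under the integral sign.
  let P : FormalMultilinearSeries ℂ (ι → ℂ) ℂ := fun k =>
    ∫ ω, (v ω * (k.factorial : ℂ)⁻¹) • T k (L ω) ∂μ
  have hPa : ∀ k y, P k (fun _ => y) = ∫ ω, v ω * (k.factorial : ℂ)⁻¹ * (L ω y) ^ k ∂μ := by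
    intro k y
    have := (ContinuousMultilinearMap.apply ℂ (fun _ : Fin k => ι → ℂ) ℂ
      (fun _ => y)).integral_comp_comm (hgi k)
    simp only [ContinuousMultilinearMap.apply_apply, _root_.smul_apply,
      hTa, smul_eq_mul] at this
    exact this.symm
  set M : ℝ := ∫ ω, ‖v ω‖ * Real.exp (r * ∑ i, ‖l ω i‖) ∂μ with hM
  have hPn : ∀ k, ‖P k‖ * r ^ k ≤ M := by
    intro k
    have h1 : ‖P k‖ ≤ ∫ ω, ‖v ω‖ * Real.exp (r * ∑ i, ‖l ω i‖) * (r ^ k)⁻¹ ∂μ := by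
      refine norm_integral_le_of_norm_le (hint.mul_const _) (Eventually.of_forall fun ω => ?_)
      rw [norm_smul, norm_mul, norm_inv, Complex.norm_natCast, mul_assoc, mul_assoc]
      refine mul_le_mul_of_nonneg_left ?_ (norm_nonneg _)
      have h1 := hfac k (r * ∑ i, ‖l ω i‖) (by positivity)
      have h2 : ‖T k (L ω)‖ ≤ (∑ i, ‖l ω i‖) ^ k :=
        (hTn k _).trans (pow_le_pow_left₀ (norm_nonneg _) (hLn ω) k)
      calc (k.factorial : ℝ)⁻¹ * ‖T k (L ω)‖ ≤ (k.factorial : ℝ)⁻¹ * (∑ i, ‖l ω i‖) ^ k := by gcongr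
        _ = (r * ∑ i, ‖l ω i‖) ^ k / k.factorial * (r ^ k)⁻¹ := by
          rw [mul_pow]; field_simp
        _ ≤ _ := by gcongr
    rw [integral_mul_const] at h1
    calc ‖P k‖ * r ^ k ≤ (M * (r ^ k)⁻¹) * r ^ k := by gcongr
      _ = M := by field_simp
  refine HasFPowerSeriesAt.analyticAt (p := P) ⟨ENNReal.ofReal r, ?_, ?_, ?_⟩
  · exact P.le_radius_of_bound M (r := ⟨r, hr.le⟩) hPn |>.trans' (by
      rw [ENNReal.ofReal, Real.toNNReal_of_nonneg hr.le]; rfl)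
  · simpa using hr
  · intro y hy
    have hyr : ‖y‖ < r := by
      simpa [Metric.mem_eball, edist_zero_right, ← ofReal_norm,
        ENNReal.ofReal_lt_ofReal_iff hr] using hy
    have hLy : ∀ ω, ‖L ω y‖ ≤ r * ∑ i, ‖l ω i‖ := fun ω => by
      refine ((L ω).le_opNorm y).trans ?_
      rw [mul_comm]
      gcongr
      exact hLn ω
    have hLym : AEStronglyMeasurable (fun ω => L ω y) μ :=
      (ContinuousLinearMap.apply ℂ ℂ y).continuous.comp_aestronglyMeasurable hLm
    have hbd : ∀ (s : Finset ℕ) ω, ∑ k ∈ s, ‖v ω * (k.factorial : ℂ)⁻¹ * (L ω y) ^ k‖ ≤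
        ‖v ω‖ * Real.exp (r * ∑ i, ‖l ω i‖) := fun s ω => by
      have : ∀ k : ℕ, ‖v ω * (k.factorial : ℂ)⁻¹ * (L ω y) ^ k‖ =
          ‖v ω‖ * (‖L ω y‖ ^ k / k.factorial) := fun k => by
        rw [norm_mul, norm_mul, norm_inv, Complex.norm_natCast, norm_pow]; ring
      simp_rw [this, ← Finset.mul_sum]
      refine mul_le_mul_of_nonneg_left ?_ (norm_nonneg _)
      refine le_trans ?_ (Real.exp_le_exp.2 (hLy ω))
      have h := NormedSpace.expSeries_div_hasSum_exp (𝔸 := ℝ) ‖L ω y‖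
      rw [← Real.exp_eq_exp_ℝ] at h
      exact sum_le_hasSum s (fun k _ => by positivity) h
    have hki : ∀ k : ℕ, Integrable (fun ω => v ω * (k.factorial : ℂ)⁻¹ * (L ω y) ^ k) μ := fun k => by
      refine Integrable.mono' hint ((hvm.mul_const _).mul (hLym.pow k))
        (Eventually.of_forall fun ω => ?_)
      exact (Finset.sum_singleton _ _).ge.trans (hbd {k} ω)
    have hs := hasSum_integral_of_summable_integral_norm hki
      (summable_of_sum_le (fun k => integral_nonneg fun _ => norm_nonneg _) (c := M) fun s => by
        rw [← integral_finsetSum _ fun k _ => (hki k).norm]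
        exact integral_mono (integrable_finsetSum _ fun k _ => (hki k).norm) hint (hbd s))
    simp_rw [hPa]
    convert hs using 1
    refine integral_congr_ae (Eventually.of_forall fun ω => ?_)
    have h := (NormedSpace.expSeries_div_hasSum_exp (𝔸 := ℂ) (L ω y)).mul_left (v ω)
    rw [← Complex.exp_eq_exp_ℂ] at h
    have h2 : HasSum (fun k : ℕ => v ω * (k.factorial : ℂ)⁻¹ * (L ω y) ^ k)
        (v ω * Complex.exp (L ω y)) := by
      refine h.congr_fun fun k => ?_
      ring
    beta_reduce
    rw [h2.tsum_eq, hv, hLa, mul_assoc, ← Complex.exp_add]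
    simp [add_mul, Finset.sum_add_distrib]

open MeasureTheory Set in
theorem integrableOn_cpow_mul_exp_neg {s a : ℂ} (hs : 0 < s.re) (ha : 0 < a.re) :
    IntegrableOn (fun t : ℝ => (t : ℂ) ^ (s - 1) * Complex.exp (-(t * a))) (Ioi 0) := by
  have h := integrableOn_rpow_mul_exp_neg_mul_rpow (p := 1) (s := s.re - 1) (by linarith)
    one_pos ha
  refine Integrable.mono' h ?_ ?_
  · refine ContinuousOn.aestronglyMeasurable ?_ measurableSet_Ioi
    refine ContinuousOn.mul (fun t ht => ?_) (by fun_prop)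
    exact (Complex.continuousAt_ofReal_cpow_const _ _ (Or.inr (ne_of_gt ht))).continuousWithinAt
  · refine (ae_restrict_iff' measurableSet_Ioi).2 (Eventually.of_forall fun t ht => ?_)
    rw [norm_mul, Complex.norm_cpow_eq_rpow_re_of_pos ht, Complex.norm_exp]
    simp [mul_comm]

open MeasureTheory Set in
/-- Euler's integral for the Gamma function along a complex ray of the right half-plane. -/
theorem integral_cpow_mul_exp_neg {s a : ℂ} (hs : 0 < s.re) (ha : 0 < a.re) :
    ∫ t in Ioi (0 : ℝ), (t : ℂ) ^ (s - 1) * Complex.exp (-(t * a)) =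
      Complex.Gamma s * a ^ (-s) := by
  have hU : IsPreconnected {z : ℂ | 0 < z.re} :=
    (convex_halfSpace_re_gt 0).isPreconnected
  have hF : AnalyticOnNhd ℂ (fun z : ℂ => ∫ t in Ioi (0 : ℝ),
      (t : ℂ) ^ (s - 1) * Complex.exp (-(t * z))) {z : ℂ | 0 < z.re} := by
    intro z (hz : 0 < z.re)
    -- With `r = z.re / 2` the weight uses up half of the decay, and `exp (-t z.re / 2)` is left.
    have h := analyticAt_integral_exp_of_integrable (ι := Unit) (μ := volume.restrict (Ioi (0 : ℝ)))
      (w := fun t => (t : ℂ) ^ (s - 1)) (l := fun t _ => -(t : ℂ)) (p := fun _ => z)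
      (r := z.re / 2) ?_ ?_ (by linarith) ?_
    · have h2 : AnalyticAt ℂ (fun z : ℂ => (fun _ : Unit => z)) z :=
        analyticAt_pi_iff.2 fun _ => analyticAt_id
      have := AnalyticAt.fun_comp h h2
      simpa [mul_comm] using this
    · refine ContinuousOn.aestronglyMeasurable (fun t ht => ?_) measurableSet_Ioi
      exact (Complex.continuousAt_ofReal_cpow_const _ _ (Or.inr (ne_of_gt ht))).continuousWithinAt
    · intro _
      exact (by fun_prop : Continuous fun t : ℝ => -(t : ℂ)).aestronglyMeasurable
    · have h := (integrableOn_cpow_mul_exp_neg (s := s) (a := (z.re / 2 : ℝ)) hs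
        (by rw [Complex.ofReal_re]; linarith)).norm
      refine h.congr ?_
      refine (ae_restrict_iff' measurableSet_Ioi).2 (Eventually.of_forall fun t ht => ?_)
      have ht : 0 < t := ht
      simp only [norm_mul, Complex.norm_exp, mul_assoc, ← Real.exp_add]
      congr 2
      simp [abs_of_pos ht]
      ring
  have hG : AnalyticOnNhd ℂ (fun z : ℂ => Complex.Gamma s * z ^ (-s)) {z : ℂ | 0 < z.re} := by
    intro z (hz : 0 < z.re)
    exact analyticAt_const.mul (AnalyticAt.cpow analyticAt_id analyticAt_const (Or.inl hz))
  -- Identity theorem in the parameter: both sides are analytic on the half-plane and agree at the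
  -- real points `u > 1`, which accumulate at `1`.
  refine hF.eqOn_of_preconnected_of_frequently_eq hG hU (z₀ := 1) (by simp) ?_ ha
  have hc : Tendsto (fun u : ℝ => (u : ℂ)) (𝓝[>] 1) (𝓝[≠] 1) := by
    refine tendsto_nhdsWithin_iff.2 ⟨?_, ?_⟩
    · exact (Complex.continuous_ofReal.tendsto' 1 1 (by simp)).mono_left nhdsWithin_le_nhds
    · filter_upwards [self_mem_nhdsWithin] with u hu
      simpa using ne_of_gt hu
  refine hc.frequently (Eventually.frequently ?_)
  filter_upwards [self_mem_nhdsWithin] with u hu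
  have hu : 0 < u := lt_trans one_pos hu
  have := Complex.integral_cpow_mul_exp_neg_mul_Ioi hs hu
  rw [one_div, Complex.inv_cpow _ _ (by rw [Complex.arg_ofReal_of_nonneg hu.le]; exact Real.pi_pos.ne),
    ← Complex.cpow_neg, mul_comm] at this
  rw [← this]
  simp_rw [mul_comm (u : ℂ)]

/-! ### Euler–Maclaurin summation and the expansion of the theta series at `0`. -/

open MeasureTheory Set in
/-- A quantitative Euler–Maclaurin formula on the half-line, for a sequence `f k` of successive
derivatives. -/
theorem exists_eulerMaclaurin_bound (M : ℕ) : ∃ C : ℝ, 0 ≤ C ∧ ∀ f : ℕ → ℝ → ℂ,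
    (∀ k x, HasDerivAt (f k) (f (k + 1) x) x) → (∀ k, IntegrableOn (f k) (Ioi 0)) →
    (∀ k, Tendsto (f k) atTop (𝓝 0)) → (Summable fun m : ℕ => f 0 (m + 1)) →
    ‖∑' m : ℕ, f 0 (m + 1) - (∫ x in Ioi 0, f 0 x) +
      ∑ k ∈ Finset.range (M + 1), ((bernoulli' (k + 1) / (k + 1).factorial : ℚ) : ℂ) * f k 0‖ ≤
      C * ∫ x in Ioi 0, ‖f (M + 1) x‖ := by
  -- The constant depends only on a Bernoulli polynomial, not on `f`; this uniformity is what
  -- permits rescaling by `t` later.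
  obtain ⟨C₀, hC₀⟩ := (isCompact_Icc (a := (0 : ℝ)) (b := 1)).exists_bound_of_continuousOn
    (f := fun x => bernoulliFun (M + 1) x) (continuous_bernoulliFun _).continuousOn
  have hC₀' : 0 ≤ C₀ := (norm_nonneg _).trans (hC₀ 0 (by simp))
  refine ⟨((M + 1).factorial : ℝ)⁻¹ * C₀, by positivity, fun f hf hint hlim hsum => ?_⟩
  have hcont : ∀ k, Continuous (f k) := fun k =>
    continuous_iff_continuousAt.2 fun x => (hf k x).continuousAt
  -- Bernoulli polynomials paired with derivatives, cell by cell; integration by parts (`hJs`)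
  -- raises the order.
  let J : ℕ → ℕ → ℂ := fun k N => ∑ m ∈ Finset.range N,
    ∫ x in (0 : ℝ)..1, (bernoulliFun k x : ℂ) * f k (m + x)
  have hJ0 : ∀ N, J 0 N = ∫ x in (0 : ℝ)..N, f 0 x := fun N => by
    have h := intervalIntegral.sum_integral_adjacent_intervals (f := f 0) (μ := volume)
      (a := fun k : ℕ => (k : ℝ)) (n := N) fun k _ => (hcont 0).intervalIntegrable _ _
    simp only [Nat.cast_zero] at h
    rw [← h]
    refine Finset.sum_congr rfl fun m _ => ?_
    simp only [bernoulliFun_zero, Complex.ofReal_one, one_mul]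
    rw [intervalIntegral.integral_comp_add_left (fun x => f 0 x)]
    simp
  have hJs : ∀ k N, J (k + 1) N = ∑ m ∈ Finset.range N,
      ((bernoulliFun (k + 1) 1 : ℂ) * f k (m + 1) - (bernoulliFun (k + 1) 0 : ℂ) * f k m) -
      (k + 1) * J k N := fun k N => by
    simp only [J, Finset.mul_sum, ← Finset.sum_sub_distrib]
    refine Finset.sum_congr rfl fun m _ => ?_
    rw [intervalIntegral.integral_mul_deriv_eq_deriv_mul (v := fun x => f k (m + x))
      (u' := fun x => (k + 1) * (bernoulliFun k x : ℂ))]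
    · simp only [mul_assoc, intervalIntegral.integral_const_mul, add_zero]
    · intro x _
      have := (hasDerivAt_bernoulliFun (k + 1) x).ofReal_comp
      simpa using this
    · intro x _
      exact (hf k (m + x)).comp_const_add (m : ℝ) x
    · exact Continuous.intervalIntegrable
        (continuous_const.mul (Complex.continuous_ofReal.comp (continuous_bernoulliFun _))) _ _
    · exact Continuous.intervalIntegrable ((hcont _).comp (continuous_const.add continuous_id)) _ _
  have hb1 : ∀ k, bernoulliFun (k + 1) 1 = bernoulli' (k + 1) := fun k => by
    rw [bernoulliFun_eval_one, bernoulliFun_eval_zero]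
    rcases k with _ | k
    · rw [zero_add, bernoulli_one, bernoulli'_one]; norm_num
    · rw [bernoulli_eq_bernoulli'_of_ne_one (by omega)]; simp
  -- Euler–Maclaurin on `[0, N]`. The sum runs over `1, …, N`, hence the convention `bernoulli'`
  -- with first value `+1/2`.
  have hA : ∀ M N, (-1 : ℂ) ^ (M + 1) / (M + 1).factorial * J (M + 1) N =
      (∫ x in (0 : ℝ)..N, f 0 x) - ∑ m ∈ Finset.range N, f 0 (m + 1) +
      ∑ k ∈ Finset.range (M + 1), ((bernoulli' (k + 1) / (k + 1).factorial : ℚ) : ℂ) *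
        (f k N - f k 0) := by
    intro M N
    induction M with
    | zero =>
      have h1 : ∑ m ∈ Finset.range N, f 0 (m + 1) = ∑ m ∈ Finset.range N, f 0 m + f 0 N - f 0 0 := by
        have := Finset.sum_range_succ' (fun m : ℕ => f 0 m) N
        rw [Finset.sum_range_succ] at this
        push_cast at this
        linear_combination -this
      rw [hJs, hJ0, Finset.sum_sub_distrib, ← Finset.mul_sum, ← Finset.mul_sum, hb1,
        bernoulliFun_eval_zero]
      simp only [zero_add, Finset.range_one, Finset.sum_singleton, bernoulli_one, bernoulli'_one,
        Nat.factorial_one]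
      push_cast
      linear_combination (1 / 2 : ℂ) * h1
    | succ M ih =>
      rw [Finset.sum_range_succ, ← add_assoc, ← ih, hJs]
      have h1 : bernoulliFun (M + 1 + 1) 0 = bernoulliFun (M + 1 + 1) 1 := by
        rw [bernoulliFun_endpoints_eq_of_ne_one (by omega)]
      rw [h1, hb1]
      have h2 : ∑ m ∈ Finset.range N, (f (M + 1) (m + 1) - f (M + 1) m) = f (M + 1) N - f (M + 1) 0 := by
        have := Finset.sum_range_sub (fun m : ℕ => f (M + 1) m) N
        push_cast at this
        exact this
      simp_rw [← mul_sub, ← Finset.mul_sum, h2]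
      -- Bernoulli numbers of odd index above `1` vanish, so the alternating sign is harmless.
      have h3 : (-1 : ℂ) ^ (M + 1 + 1) * (((bernoulli' (M + 1 + 1) : ℚ) : ℝ) : ℂ) =
          ((bernoulli' (M + 1 + 1) : ℚ) : ℂ) := by
        rcases Nat.even_or_odd (M + 1 + 1) with h | h
        · rw [h.neg_one_pow, one_mul]; push_cast; rfl
        · rw [bernoulli'_eq_zero_of_odd h (by omega)]; simp
      have h4 : ((M + 1 + 1).factorial : ℂ) = (M + 1 + 1) * (M + 1).factorial := by
        rw [Nat.factorial_succ]; push_cast; ring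
      have h5 : ((M + 1).factorial : ℂ) ≠ 0 := by exact_mod_cast Nat.factorial_ne_zero _
      have h6 : (M + 1 + 1 : ℂ) ≠ 0 := by exact_mod_cast Nat.succ_ne_zero (M + 1)
      have h7 : ((bernoulli' (M + 1 + 1) / (M + 1 + 1).factorial : ℚ) : ℂ) =
          (-1 : ℂ) ^ (M + 1 + 1) * (((bernoulli' (M + 1 + 1) : ℚ) : ℝ) : ℂ) /
            ((M + 1 + 1) * (M + 1).factorial) := by
        rw [h3, ← h4]; push_cast; rfl
      rw [h7, h4, pow_succ _ (M + 1)]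
      push_cast
      field_simp
      ring
  have hbound : ∀ N : ℕ, ‖J (M + 1) N‖ ≤ C₀ * ∫ x in Ioi 0, ‖f (M + 1) x‖ := fun N => by
    have hn := (hcont (M + 1)).norm
    calc ‖J (M + 1) N‖ ≤ ∑ m ∈ Finset.range N, C₀ * ∫ x in (m : ℝ)..(m + 1 : ℕ), ‖f (M + 1) x‖ := by
          refine (norm_sum_le _ _).trans (Finset.sum_le_sum fun m _ => ?_)
          have : ∫ x in (m : ℝ)..(m + 1 : ℕ), ‖f (M + 1) x‖ =
              ∫ x in (0 : ℝ)..1, ‖f (M + 1) (m + x)‖ := by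
            rw [intervalIntegral.integral_comp_add_left (fun x => ‖f (M + 1) x‖)]
            simp
          rw [this, ← intervalIntegral.integral_const_mul]
          refine intervalIntegral.norm_integral_le_of_norm_le zero_le_one ?_
            (Continuous.intervalIntegrable (by fun_prop) _ _)
          refine Eventually.of_forall fun x hx => ?_
          rw [norm_mul, Complex.norm_real]
          gcongr
          exact hC₀ x ⟨hx.1.le, hx.2⟩
      _ = C₀ * ∫ x in (0 : ℝ)..N, ‖f (M + 1) x‖ := by
          rw [← Finset.mul_sum, intervalIntegral.sum_integral_adjacent_intervals
            (a := fun k : ℕ => (k : ℝ)) fun k _ => hn.intervalIntegrable _ _]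
          simp
      _ ≤ _ := by
          gcongr
          rw [intervalIntegral.integral_of_le (Nat.cast_nonneg N)]
          exact setIntegral_mono_set (hint _).norm (Eventually.of_forall fun _ => norm_nonneg _)
            (Eventually.of_forall fun x hx => hx.1)
  have hlimN : Tendsto (fun N : ℕ => (∫ x in (0 : ℝ)..N, f 0 x) -
      ∑ m ∈ Finset.range N, f 0 (m + 1) +
      ∑ k ∈ Finset.range (M + 1), ((bernoulli' (k + 1) / (k + 1).factorial : ℚ) : ℂ) *
        (f k N - f k 0)) atTop (𝓝 ((∫ x in Ioi 0, f 0 x) - ∑' m : ℕ, f 0 (m + 1) +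
      ∑ k ∈ Finset.range (M + 1), ((bernoulli' (k + 1) / (k + 1).factorial : ℚ) : ℂ) *
        (0 - f k 0))) := by
    refine ((intervalIntegral_tendsto_integral_Ioi 0 (hint 0) tendsto_natCast_atTop_atTop).sub
      hsum.hasSum.tendsto_sum_nat).add (tendsto_finsetSum _ fun k _ => ?_)
    exact (((hlim k).comp tendsto_natCast_atTop_atTop).sub_const _).const_mul _
  have h := le_of_tendsto hlimN.norm (Eventually.of_forall fun N => by
    rw [← hA, norm_mul, norm_div, norm_pow, norm_neg, norm_one, one_pow, Complex.norm_natCast,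
      one_div]
    exact mul_le_mul_of_nonneg_left (hbound N) (by positivity))
  rw [mul_assoc, ← norm_neg]
  convert! h using 2
  simp only [zero_sub, mul_neg, Finset.sum_neg_distrib]
  ring

noncomputable section

/-- The polynomials `P k` with `(d/dx)^k exp (-c x^d) = P k (x) exp (-c x^d)`. -/
def expMonomialDerivPoly (d : ℕ) (c : ℂ) : ℕ → Polynomial ℂ
  | 0 => 1
  | k + 1 => Polynomial.derivative (expMonomialDerivPoly d c k) -
      Polynomial.C (c * d) * Polynomial.X ^ (d - 1) * expMonomialDerivPoly d c k

theorem hasDerivAt_expMonomialDerivPoly (d : ℕ) (c : ℂ) (k : ℕ) (x : ℝ) :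
    HasDerivAt (fun x : ℝ => (expMonomialDerivPoly d c k).eval (x : ℂ) * Complex.exp (-c * x ^ d))
      ((expMonomialDerivPoly d c (k + 1)).eval (x : ℂ) * Complex.exp (-c * x ^ d)) x := by
  have h1 : HasDerivAt (fun z : ℂ => (expMonomialDerivPoly d c k).eval z * Complex.exp (-c * z ^ d))
      ((expMonomialDerivPoly d c (k + 1)).eval (x : ℂ) * Complex.exp (-c * x ^ d)) (x : ℂ) := by
    convert! ((expMonomialDerivPoly d c k).hasDerivAt (x : ℂ)).mul
      (((hasDerivAt_pow d (x : ℂ)).const_mul (-c)).cexp) using 1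
    simp [expMonomialDerivPoly]
    ring
  exact h1.comp_ofReal

/-- The formal power series `exp (-c X^d)`. -/
def expMonomialSeries (d : ℕ) (c : ℂ) : PowerSeries ℂ :=
  PowerSeries.mk fun k => if d ∣ k then (-c) ^ (k / d) / (k / d).factorial else 0

/-- The differential equation behind the recursion of `expMonomialDerivPoly`; only indices `k` with
`d ∣ k + 1` contribute. -/
theorem derivative_expMonomialSeries {d : ℕ} (hd : 0 < d) (c : ℂ) :
    PowerSeries.derivative ℂ (expMonomialSeries d c) =
      -(PowerSeries.C (c * d) * PowerSeries.X ^ (d - 1) * expMonomialSeries d c) := by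
  ext k
  rw [PowerSeries.coeff_derivative, map_neg, mul_assoc, PowerSeries.coeff_C_mul,
    PowerSeries.coeff_X_pow_mul']
  simp only [expMonomialSeries, PowerSeries.coeff_mk]
  by_cases hk : d ∣ k + 1
  · obtain ⟨l, hl⟩ := hk
    obtain ⟨l, rfl⟩ : ∃ l', l = l' + 1 := ⟨l - 1, by
      rcases l with _ | l
      · omega
      · omega⟩
    have hk : k - (d - 1) = d * l := by rw [mul_add] at hl; omega
    have hle : d - 1 ≤ k := by rw [mul_add] at hl; have := Nat.zero_le (d * l); omega
    rw [if_pos hle, hk, hl, if_pos (dvd_mul_right _ _), if_pos (dvd_mul_right _ _),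
      Nat.mul_div_cancel_left _ hd, Nat.mul_div_cancel_left _ hd]
    have h2 : (k + 1 : ℂ) = d * (l + 1) := by exact_mod_cast hl
    have h5 : (l.factorial : ℂ) ≠ 0 := by exact_mod_cast Nat.factorial_ne_zero _
    have h6 : (l + 1 : ℂ) ≠ 0 := by exact_mod_cast Nat.succ_ne_zero l
    rw [h2, Nat.factorial_succ]
    push_cast
    field_simp
    ring
  · rw [if_neg hk]
    by_cases hle : d - 1 ≤ k
    · rw [if_pos hle, if_neg]
      · simp
      · intro h
        apply hk
        have : k + 1 = (k - (d - 1)) + d := by omega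
        rw [this]
        exact dvd_add h dvd_rfl
    · rw [if_neg hle]; simp

/-- The formal series obeys the same recursion: its `k`-th derivative is `P k` times itself. Its
constant term is `1`, so comparing constant terms gives the value. -/
theorem eval_zero_expMonomialDerivPoly {d : ℕ} (hd : 0 < d) (c : ℂ) (k : ℕ) :
    (expMonomialDerivPoly d c k).eval 0 =
      k.factorial * (if d ∣ k then (-c) ^ (k / d) / (k / d).factorial else 0) := by
  have h1 : ∀ k, (PowerSeries.derivative ℂ)^[k] (expMonomialSeries d c) =
      (expMonomialDerivPoly d c k : PowerSeries ℂ) * expMonomialSeries d c := by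
    intro k
    induction k with
    | zero => simp [expMonomialDerivPoly]
    | succ k ih =>
      rw [Function.iterate_succ_apply', ih, Derivation.leibniz,
        derivative_expMonomialSeries hd, PowerSeries.derivative_coe, expMonomialDerivPoly]
      push_cast
      simp only [smul_eq_mul]
      ring
  have h2 : ∀ (k : ℕ) (f : PowerSeries ℂ), PowerSeries.constantCoeff
      ((PowerSeries.derivative ℂ)^[k] f) = k.factorial * PowerSeries.coeff k f := by
    intro k
    induction k with
    | zero => intro f; simp
    | succ k ih =>
      intro f
      rw [Function.iterate_succ_apply, ih, PowerSeries.coeff_derivative, Nat.factorial_succ]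
      push_cast
      ring
  have h3 := h2 k (expMonomialSeries d c)
  rw [h1, map_mul] at h3
  have h4 : PowerSeries.constantCoeff (expMonomialSeries d c) = 1 := by
    rw [← PowerSeries.coeff_zero_eq_constantCoeff_apply, expMonomialSeries, PowerSeries.coeff_mk]
    simp
  rw [h4, mul_one, expMonomialSeries, PowerSeries.coeff_mk] at h3
  rw [← h3, ← PowerSeries.coeff_zero_eq_constantCoeff_apply, Polynomial.coeff_coe,
    Polynomial.coeff_zero_eq_eval_zero]

open MeasureTheory Set in
theorem integrableOn_eval_mul_exp_neg_pow {d : ℕ} (hd : 0 < d) {c : ℂ} (hc : 0 < c.re)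
    (P : Polynomial ℂ) :
    IntegrableOn (fun x : ℝ => P.eval (x : ℂ) * Complex.exp (-c * x ^ d)) (Ioi 0) := by
  induction P using Polynomial.induction_on' with
  | add p q hp hq =>
    simp only [Polynomial.eval_add, add_mul]
    exact Integrable.add hp hq
  | monomial n a =>
    have h := (integrableOn_rpow_mul_exp_neg_mul_rpow (p := d) (s := n) (b := c.re)
      (by have : (0 : ℝ) ≤ n := Nat.cast_nonneg n
          linarith) (by exact_mod_cast hd) hc).const_mul ‖a‖
    refine Integrable.mono' h (Continuous.aestronglyMeasurable (by fun_prop)) ?_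
    refine (ae_restrict_iff' measurableSet_Ioi).2 (Eventually.of_forall fun x hx => ?_)
    have hx : 0 < x := hx
    have : (-c * (x : ℂ) ^ d).re = -c.re * x ^ d := by
      rw [← Complex.ofReal_pow, Complex.re_mul_ofReal]; simp
    rw [Polynomial.eval_monomial, norm_mul, norm_mul, Complex.norm_exp, this, Real.rpow_natCast,
      Real.rpow_natCast, norm_pow, Complex.norm_real, Real.norm_of_nonneg hx.le, mul_assoc]

theorem tendsto_eval_mul_exp_neg_pow {d : ℕ} (hd : 0 < d) {c : ℂ} (hc : 0 < c.re)
    (P : Polynomial ℂ) :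
    Tendsto (fun x : ℝ => P.eval (x : ℂ) * Complex.exp (-c * x ^ d)) atTop (𝓝 0) := by
  induction P using Polynomial.induction_on' with
  | add p q hp hq => simpa [add_mul] using hp.add hq
  | monomial n a =>
    have h1 : Tendsto (fun x : ℝ => x ^ n * Real.exp (-c.re * x)) atTop (𝓝 0) := by
      have := tendsto_rpow_mul_exp_neg_mul_atTop_nhds_zero (n : ℝ) c.re hc
      simpa using this
    refine squeeze_zero_norm' ?_ (by simpa using h1.const_mul ‖a‖)
    filter_upwards [eventually_ge_atTop 1] with x hx
    have : (-c * (x : ℂ) ^ d).re = -c.re * x ^ d := by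
      rw [← Complex.ofReal_pow, Complex.re_mul_ofReal]; simp
    rw [Polynomial.eval_monomial, norm_mul, norm_mul, Complex.norm_exp, this,
      norm_pow, Complex.norm_real, Real.norm_of_nonneg (by linarith), mul_assoc]
    have h2 : x ≤ x ^ d := le_self_pow₀ hx hd.ne'
    gcongr ‖a‖ * (x ^ n * Real.exp ?_)
    nlinarith

/-- The generalised theta series `∑_{m ≥ 1} exp (-c m^d t)`. -/
def powerTheta (d : ℕ) (c : ℂ) (t : ℝ) : ℂ :=
  ∑' m : ℕ, Complex.exp (-(t * (c * ((m : ℂ) + 1) ^ d)))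

/-- The value `ζ(-dk)`, as a rational number. -/
def negZeta (d k : ℕ) : ℚ := -bernoulli' (d * k + 1) / (d * k + 1)

open MeasureTheory Set in
/-- The integral of `exp (-c x^d)` over the half-line. -/
def thetaConst (d : ℕ) (c : ℂ) : ℂ := ∫ x in Ioi (0 : ℝ), Complex.exp (-c * x ^ d)

/-- The error in the expansion of `powerTheta` at `0`, truncated at order `K`. -/
def thetaRemainder (d : ℕ) (c : ℂ) (K : ℕ) (t : ℝ) : ℂ :=
  powerTheta d c t - thetaConst d c * (t : ℂ) ^ (-(1 / d : ℂ)) -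
    ∑ k ∈ Finset.range K, (negZeta d k : ℂ) * ((-c) ^ k / k.factorial) * (t : ℂ) ^ k

theorem summable_exp_neg_mul_pow {d : ℕ} (hd : 0 < d) {c : ℂ} (hc : 0 < c.re) {t : ℝ} (ht : 0 < t) :
    Summable fun m : ℕ => Complex.exp (-(t * (c * ((m : ℂ) + 1) ^ d))) := by
  have h : Summable fun m : ℕ => Real.exp (m * -(t * c.re)) :=
    Real.summable_exp_nat_mul_iff.2 (by nlinarith [mul_pos ht hc])
  refine Summable.of_norm_bounded h fun m => ?_
  rw [Complex.norm_exp]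
  have h1 : (-((t : ℂ) * (c * ((m : ℂ) + 1) ^ d))).re = -(t * (c.re * ((m : ℝ) + 1) ^ d)) := by
    rw [Complex.neg_re, Complex.re_ofReal_mul]
    have : ((m : ℂ) + 1) ^ d = (((m : ℝ) + 1) ^ d : ℝ) := by push_cast; rfl
    rw [this, Complex.re_mul_ofReal]
  rw [h1]
  have h2 : (m : ℝ) ≤ ((m : ℝ) + 1) ^ d :=
    le_trans (by linarith) (le_self_pow₀ (by linarith [Nat.cast_nonneg (α := ℝ) m]) hd.ne')
  have h3 := mul_pos ht hc
  apply Real.exp_le_exp.2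
  nlinarith

open MeasureTheory Set in
-- Euler–Maclaurin is applied to `x ↦ exp (-c (hx)^d)` with `h = t^(1/d)`. Since that formula has an
-- exact error bound, the estimate holds for every `t > 0`, not only near `0`.
theorem exists_norm_thetaRemainder_le {d : ℕ} (hd : 0 < d) {c : ℂ} (hc : 0 < c.re) (K : ℕ) :
    ∃ C : ℝ, 0 ≤ C ∧ ∀ t : ℝ, 0 < t → ‖thetaRemainder d c K t‖ ≤ C * t ^ K := by
  -- With this order the error involves the derivative of order `dK + 1`, which scales as
  -- `h^(dK+1)`; the substitution costs `h⁻¹`, leaving `h^(dK) = t^K`.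
  obtain ⟨C, hC0, hC⟩ := exists_eulerMaclaurin_bound (d * K)
  set g : ℕ → ℝ → ℂ := fun k x =>
    (expMonomialDerivPoly d c k).eval (x : ℂ) * Complex.exp (-c * x ^ d) with hg
  have hgi : ∀ k, IntegrableOn (g k) (Ioi 0) := fun k => integrableOn_eval_mul_exp_neg_pow hd hc _
  -- The second summand is the `k = K` term, which Euler–Maclaurin includes and `thetaRemainder` of
  -- order `K` does not subtract.
  refine ⟨C * (∫ x in Ioi 0, ‖g (d * K + 1) x‖) +
    ‖(negZeta d K : ℂ) * ((-c) ^ K / K.factorial)‖, by positivity, fun t ht => ?_⟩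
  set h : ℝ := t ^ (1 / d : ℝ) with hh
  have h0 : 0 < h := Real.rpow_pos_of_pos ht _
  have hd' : (d : ℝ) ≠ 0 := by exact_mod_cast hd.ne'
  have hpow : ∀ k, h ^ (d * k) = t ^ k := fun k => by
    rw [pow_mul, hh, ← Real.rpow_natCast (t ^ (1 / d : ℝ)), ← Real.rpow_mul ht.le]
    simp [hd']
  have hhd : h ^ d = t := by simpa using hpow 1
  set f : ℕ → ℝ → ℂ := fun k x => (h : ℂ) ^ k * g k (h * x) with hf
  have hsc : ∀ G : ℝ → ℂ, ∫ x in Ioi (0 : ℝ), G (h * x) = (h : ℂ)⁻¹ * ∫ x in Ioi 0, G x := fun G => by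
    rw [integral_comp_mul_left_Ioi _ _ h0, mul_zero, Complex.real_smul, Complex.ofReal_inv]
  have hf0 : ∀ m : ℕ, f 0 (m + 1) = Complex.exp (-(t * (c * ((m : ℂ) + 1) ^ d))) := fun m => by
    simp only [hf, hg, expMonomialDerivPoly, Polynomial.eval_one, pow_zero, one_mul]
    congr 1
    rw [← hhd]
    push_cast
    rw [mul_pow]
    ring
  have hE := hC f ?_ ?_ ?_ ?_
  rotate_left
  · intro k x
    have := ((hasDerivAt_expMonomialDerivPoly d c k (h * x)).scomp x
      ((hasDerivAt_id x).const_mul h)).const_mul ((h : ℂ) ^ k)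
    refine this.congr_deriv ?_
    simp only [hf, hg, Complex.real_smul, mul_one, pow_succ]
    ring
  · intro k
    refine Integrable.const_mul ?_ _
    have := (integrableOn_Ioi_comp_mul_left_iff (g k) 0 h0).2 (by simpa using hgi k)
    exact this
  · intro k
    have := ((tendsto_eval_mul_exp_neg_pow hd hc (expMonomialDerivPoly d c k)).comp
      (tendsto_id.const_mul_atTop h0)).const_mul ((h : ℂ) ^ k)
    simpa [hf, hg, Function.comp_def] using this
  · simp_rw [hf0]
    exact summable_exp_neg_mul_pow hd hc ht
  have hI : ∫ x in Ioi 0, f 0 x = (∫ x in Ioi (0 : ℝ), Complex.exp (-c * x ^ d)) *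
      (t : ℂ) ^ (-(1 / d : ℂ)) := by
    have : (t : ℂ) ^ (-(1 / d : ℂ)) = (h : ℂ)⁻¹ := by
      rw [Complex.cpow_neg, hh, Complex.ofReal_cpow ht.le]; push_cast; rfl
    rw [this, mul_comm, ← hsc]
    simp [hf, hg, expMonomialDerivPoly]
  have hR : ∫ x in Ioi 0, ‖f (d * K + 1) x‖ = t ^ K * ∫ x in Ioi 0, ‖g (d * K + 1) x‖ := by
    simp only [hf, norm_mul, norm_pow, Complex.norm_real, Real.norm_of_nonneg h0.le,
      integral_const_mul]
    rw [integral_comp_mul_left_Ioi (fun x => ‖g (d * K + 1) x‖) _ h0, mul_zero, pow_succ, hpow,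
      smul_eq_mul]
    field_simp
  -- Only derivatives of order divisible by `d` survive at `0`; the order `dk` produces `ζ(-dk)`.
  have hS : ∑ k ∈ Finset.range (d * K + 1),
      ((bernoulli' (k + 1) / (k + 1).factorial : ℚ) : ℂ) * f k 0 =
      -∑ k ∈ Finset.range (K + 1), (negZeta d k : ℂ) * ((-c) ^ k / k.factorial) * (t : ℂ) ^ k := by
    have hsub : (Finset.range (K + 1)).image (fun k => d * k) ⊆ Finset.range (d * K + 1) := by
      intro k hk
      obtain ⟨l, hl, rfl⟩ := Finset.mem_image.1 hk
      have := Nat.mul_le_mul_left d (Nat.lt_succ_iff.1 (Finset.mem_range.1 hl))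
      exact Finset.mem_range.2 (by omega)
    have hfk : ∀ k, f k 0 = (h : ℂ) ^ k * (k.factorial *
        (if d ∣ k then (-c) ^ (k / d) / (k / d).factorial else 0)) := fun k => by
      rw [← eval_zero_expMonomialDerivPoly hd]
      simp [hf, hg, hd.ne']
    rw [← Finset.sum_subset hsub, Finset.sum_image, ← Finset.sum_neg_distrib]
    · refine Finset.sum_congr rfl fun k _ => ?_
      rw [hfk, if_pos (dvd_mul_right _ _), Nat.mul_div_cancel_left _ hd, ← Complex.ofReal_pow, hpow,
        negZeta, Nat.factorial_succ]
      have h5 : ((d * k).factorial : ℂ) ≠ 0 := by exact_mod_cast Nat.factorial_ne_zero _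
      have h6 : ((d * k + 1 : ℕ) : ℂ) ≠ 0 := by exact_mod_cast Nat.succ_ne_zero (d * k)
      push_cast at h6 ⊢
      field_simp
    · intro a _ b _ hab
      exact Nat.eq_of_mul_eq_mul_left hd hab
    · intro k hk hk'
      rw [hfk, if_neg]
      · simp
      · rintro ⟨l, rfl⟩
        refine hk' (Finset.mem_image.2 ⟨l, ?_, rfl⟩)
        have := Finset.mem_range.1 hk
        refine Finset.mem_range.2 ?_
        by_contra hl
        have := Nat.mul_le_mul_left d (not_lt.1 hl)
        rw [mul_add] at this
        omega
  rw [hI, hR, hS] at hE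
  simp_rw [hf0] at hE
  rw [Finset.sum_range_succ] at hE
  have key : thetaRemainder d c K t =
      (powerTheta d c t - (∫ x in Ioi (0 : ℝ), Complex.exp (-c * x ^ d)) *
      (t : ℂ) ^ (-(1 / d : ℂ)) +
        -(∑ k ∈ Finset.range K, (negZeta d k : ℂ) * ((-c) ^ k / k.factorial) * (t : ℂ) ^ k +
          (negZeta d K : ℂ) * ((-c) ^ K / K.factorial) * (t : ℂ) ^ K)) +
        (negZeta d K : ℂ) * ((-c) ^ K / K.factorial) * (t : ℂ) ^ K := by
    rw [thetaRemainder, thetaConst]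
    ring
  rw [key]
  refine (norm_add_le _ _).trans ?_
  rw [norm_mul _ ((t : ℂ) ^ K), norm_pow, Complex.norm_real, Real.norm_of_nonneg ht.le, add_mul]
  refine add_le_add (hE.trans (le_of_eq ?_)) le_rfl
  ring

end

/-! ### Absolute convergence of the multiple series, and peeling off the last variable. -/

noncomputable section

theorem Fin.sum_Iic_last {M : Type*} [AddCommMonoid M] {n : ℕ} (f : Fin (n + 2) → M) :
    ∑ i ∈ Finset.Iic (Fin.last (n + 1)), f i =
      ∑ i ∈ Finset.Iic (Fin.last n), f i.castSucc + f (Fin.last (n + 1)) := by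
  rw [← Fin.top_eq_last, Finset.Iic_top, ← Fin.top_eq_last, Finset.Iic_top, Fin.sum_univ_castSucc,
    Fin.top_eq_last]

theorem Fin.sum_Ici_castSucc {M : Type*} [AddCommMonoid M] {n : ℕ} (f : Fin (n + 1) → M)
    (j : Fin n) : ∑ i ∈ Finset.Ici j.castSucc, f i =
      ∑ i ∈ Finset.Ici j, f i.castSucc + f (Fin.last n) := by
  rw [← Finset.univ_inter (Finset.Ici j.castSucc), ← Finset.univ_inter (Finset.Ici j),
    ← Finset.sum_ite_mem, ← Finset.sum_ite_mem, Fin.sum_univ_castSucc]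
  simp [Fin.le_last]

theorem Fin.sum_Ioi_castSucc {M : Type*} [AddCommMonoid M] {n : ℕ} (f : Fin (n + 1) → M)
    (j : Fin n) : ∑ i ∈ Finset.Ioi j.castSucc, f i =
      ∑ i ∈ Finset.Ioi j, f i.castSucc + f (Fin.last n) := by
  rw [← Finset.univ_inter (Finset.Ioi j.castSucc), ← Finset.univ_inter (Finset.Ioi j),
    ← Finset.sum_ite_mem, ← Finset.sum_ite_mem, Fin.sum_univ_castSucc]
  simp [Fin.castSucc_lt_last]

theorem Fin.sum_Ici_last {M : Type*} [AddCommMonoid M] {n : ℕ} (f : Fin (n + 1) → M) :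
    ∑ i ∈ Finset.Ici (Fin.last n), f i = f (Fin.last n) := by
  rw [← Fin.top_eq_last, Finset.Ici_top, Finset.sum_singleton]

/-- Drop the last variable of a tuple, adding it together with `c` to the one before. -/
def tailShift {R : Type*} [AddCommMonoid R] {n : ℕ} (s : Fin (n + 2) → R) (c : R) :
    Fin (n + 1) → R :=
  fun j => s j.castSucc + if j = Fin.last n then s (Fin.last (n + 1)) + c else 0

/-- Every tail sum changes by `c` alone, so conditions phrased by tail sums transform simply. -/
theorem sum_Ici_tailShift {R : Type*} [AddCommMonoid R] {n : ℕ} (s : Fin (n + 2) → R) (c : R)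
    (j : Fin (n + 1)) :
    ∑ k ∈ Finset.Ici j, tailShift s c k = ∑ k ∈ Finset.Ici j.castSucc, s k + c := by
  simp [tailShift, Finset.sum_add_distrib, Fin.sum_Ici_castSucc, Fin.le_last, add_assoc]

theorem prod_rpow_neg_tailShift {n : ℕ} {x : Fin (n + 1) → ℝ} (hx : ∀ j, 0 < x j)
    (s : Fin (n + 2) → ℝ) (c : ℝ) :
    ∏ j, x j ^ (-tailShift s c j) =
      (∏ j, x j ^ (-s j.castSucc)) * x (Fin.last n) ^ (-(s (Fin.last (n + 1)) + c)) := by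
  have : ∀ j, x j ^ (-tailShift s c j) = x j ^ (-s j.castSucc) *
      (if j = Fin.last n then x (Fin.last n) ^ (-(s (Fin.last (n + 1)) + c)) else 1) := by
    intro j
    rw [tailShift, neg_add, Real.rpow_add (hx j)]
    split_ifs with h
    · rw [h]
    · simp
  simp_rw [this, Finset.prod_mul_distrib]
  simp

theorem summable_pnat_rpow {d : ℕ} (hd : 0 < d) {g τ : ℝ} (hg : 0 < g) (hτ : 1 / (d : ℝ) < τ) :
    Summable fun m : ℕ+ => (g * ((m : ℕ) : ℝ) ^ d) ^ (-τ) := by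
  have hd' : (0 : ℝ) < d := by exact_mod_cast hd
  have h : Summable fun m : ℕ+ => g ^ (-τ) * ((m : ℕ) : ℝ) ^ (-(d * τ)) := by
    refine Summable.mul_left _ ?_
    have h1 : Summable fun m : ℕ => (m : ℝ) ^ (-(d * τ)) := by
      rw [Real.summable_nat_rpow]
      rw [div_lt_iff₀ hd'] at hτ
      linarith
    exact h1.comp_injective PNat.coe_injective
  refine h.congr fun m => ?_
  rw [Real.mul_rpow hg.le (by positivity), ← Real.rpow_natCast_mul (by positivity)]
  ring_nf

theorem sum_mul_pow_pos {n : ℕ} {d : Fin n → ℕ} {g : Fin n → ℝ} (hg : ∀ j, 0 < g j)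
    (m : Fin n → ℕ+) (j : Fin n) : 0 < ∑ i ∈ Finset.Iic j, g i * ((m i : ℕ) : ℝ) ^ d i := by
  refine Finset.sum_pos (fun i _ => ?_) ⟨j, by simp⟩
  have := hg i
  have := (m i).pos
  positivity

/-- The last base `b + y` dominates both the previous partial sum `b` and the new term `y`, so `(b +
y)^(-σ) ≤ y^(-τ) b^(-(σ-τ))`. This bounds the series by a one-variable series times one in fewer
variables. -/
theorem summable_prod_rpow_neg {n : ℕ} (d : Fin (n + 1) → ℕ) (hd : ∀ j, 0 < d j)
    (g : Fin (n + 1) → ℝ) (hg : ∀ j, 0 < g j) (σ : Fin (n + 1) → ℝ)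
    (hσ : ∀ j, ∑ k ∈ Finset.Ici j, (1 : ℝ) / d k < ∑ k ∈ Finset.Ici j, σ k) :
    Summable fun m : Fin (n + 1) → ℕ+ =>
      ∏ j, (∑ i ∈ Finset.Iic j, g i * ((m i : ℕ) : ℝ) ^ d i) ^ (-σ j) := by
  induction n with
  | zero =>
    rw [← (Equiv.funUnique (Fin 1) ℕ+).symm.summable_iff]
    have h := hσ 0
    have h0 : Finset.Ici (0 : Fin 1) = {0} := rfl
    have h1 : Finset.Iic (0 : Fin 1) = {0} := rfl
    simp only [h0, Finset.sum_singleton] at h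
    refine (summable_pnat_rpow (hd 0) (hg 0) h).congr fun m => ?_
    simp [h1]
  | succ n ih =>
    -- All conditions are strict and hold at `τ = 1/d`, except the first; any `τ` slightly larger
    -- works.
    obtain ⟨τ, hτ1, hτ2, hτ3⟩ : ∃ τ, 1 / (d (Fin.last (n + 1)) : ℝ) < τ ∧
        τ < σ (Fin.last (n + 1)) ∧ ∀ j : Fin (n + 1),
          ∑ k ∈ Finset.Ici j, (1 : ℝ) / d k.castSucc <
            ∑ k ∈ Finset.Ici j.castSucc, σ k + -τ := by
      have h : ∀ᶠ τ in 𝓝[>] (1 / (d (Fin.last (n + 1)) : ℝ)), τ < σ (Fin.last (n + 1)) ∧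
          ∀ j : Fin (n + 1), ∑ k ∈ Finset.Ici j, (1 : ℝ) / d k.castSucc <
            ∑ k ∈ Finset.Ici j.castSucc, σ k + -τ := by
        refine nhdsWithin_le_nhds (Filter.Eventually.and ?_ (eventually_all.2 fun j => ?_))
        · have := hσ (Fin.last (n + 1))
          rw [Fin.sum_Ici_last, Fin.sum_Ici_last] at this
          exact Iio_mem_nhds this
        · have h1 := hσ j.castSucc
          rw [Fin.sum_Ici_castSucc (fun k => (1 : ℝ) / d k)] at h1
          filter_upwards [Iio_mem_nhds (lt_sub_iff_add_lt'.2 h1)] with τ hτ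
          have : τ < _ := hτ
          linarith
      obtain ⟨τ, h1, h2⟩ := (h.and self_mem_nhdsWithin).exists
      exact ⟨τ, h2, h1.1, h1.2⟩
    have h := ih (fun j => d j.castSucc) (fun j => hd _) (fun j => g j.castSucc) (fun j => hg _)
      (tailShift σ (-τ)) (fun j => by rw [sum_Ici_tailShift]; exact hτ3 j)
    have h2 := summable_pnat_rpow (hd (Fin.last (n + 1))) (hg (Fin.last (n + 1))) hτ1
    have hd0 : 0 < 1 / (d (Fin.last (n + 1)) : ℝ) := by
      have := hd (Fin.last (n + 1)); positivity
    rw [← (Fin.snocEquiv fun _ => ℕ+).summable_iff]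
    refine Summable.of_nonneg_of_le (fun p => ?_) (fun p => ?_) (h2.mul_of_nonneg h ?_ ?_)
    · exact Finset.prod_nonneg fun j _ => Real.rpow_nonneg (sum_mul_pow_pos hg _ j).le _
    · obtain ⟨m, p⟩ := p
      have hsn : (Fin.snocEquiv fun _ => ℕ+) (m, p) = (Fin.snoc p m : Fin (n + 2) → ℕ+) := rfl
      simp only [Function.comp_apply, hsn]
      rw [prod_rpow_neg_tailShift (sum_mul_pow_pos (fun j => hg _) p), Fin.prod_univ_castSucc]
      simp only [Fin.sum_Iic_castSucc, Fin.sum_Iic_last, Fin.snoc_castSucc, Fin.snoc_last]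
      rw [mul_left_comm]
      refine mul_le_mul_of_nonneg_left ?_ (Finset.prod_nonneg fun j _ =>
        Real.rpow_nonneg (sum_mul_pow_pos (fun j => hg _) p j).le _)
      have hb := sum_mul_pow_pos (d := fun j => d j.castSucc) (fun j => hg j.castSucc) p (Fin.last n)
      set b := ∑ i ∈ Finset.Iic (Fin.last n), g i.castSucc * ((p i : ℕ) : ℝ) ^ d i.castSucc
      have hy : 0 < g (Fin.last (n + 1)) * ((m : ℕ) : ℝ) ^ d (Fin.last (n + 1)) := by
        have := hg (Fin.last (n + 1)); have := m.pos; positivity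
      set y := g (Fin.last (n + 1)) * ((m : ℕ) : ℝ) ^ d (Fin.last (n + 1))
      have : -σ (Fin.last (n + 1)) = -τ + -(σ (Fin.last (n + 1)) + -τ) := by ring
      rw [this, Real.rpow_add (by positivity)]
      gcongr ?_ * ?_
      · exact Real.rpow_le_rpow_of_nonpos hy (by linarith) (by linarith)
      · exact Real.rpow_le_rpow_of_nonpos hb (by linarith) (by linarith)
    · intro m
      exact Real.rpow_nonneg (by have := hg (Fin.last (n + 1)); positivity) _
    · intro p
      exact Finset.prod_nonneg fun j _ =>
        Real.rpow_nonneg (sum_mul_pow_pos (fun j => hg _) _ j).le _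

/-- The partial sums `γ₁ m₁^{d₁} + ⋯ + γⱼ mⱼ^{dⱼ}`. -/
def powerForm {n : ℕ} (d : Fin n → ℕ) (γ : Fin n → ℂ) (m : Fin n → ℕ+) (j : Fin n) : ℂ :=
  ∑ i ∈ Finset.Iic j, γ i * ((m i : ℕ) : ℂ) ^ d i

section powerForm

variable {n : ℕ} {d : Fin n → ℕ} {γ : Fin n → ℂ}

theorem powerForm_re (m : Fin n → ℕ+) (j : Fin n) :
    (powerForm d γ m j).re = ∑ i ∈ Finset.Iic j, (γ i).re * ((m i : ℕ) : ℝ) ^ d i := by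
  rw [powerForm, Complex.re_sum]
  refine Finset.sum_congr rfl fun i _ => ?_
  have : ((m i : ℕ) : ℂ) ^ d i = (((m i : ℕ) : ℝ) ^ d i : ℝ) := by push_cast; rfl
  rw [this, Complex.re_mul_ofReal]

theorem powerForm_re_pos (hγ : ∀ j, 0 < (γ j).re) (m : Fin n → ℕ+) (j : Fin n) :
    0 < (powerForm d γ m j).re := by
  rw [powerForm_re]; exact sum_mul_pow_pos hγ m j

theorem powerForm_ne_zero (hγ : ∀ j, 0 < (γ j).re) (m : Fin n → ℕ+) (j : Fin n) :
    powerForm d γ m j ≠ 0 := fun h => by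
  have := powerForm_re_pos (d := d) hγ m j
  rw [h] at this
  simp at this

/-- The terms lie on finitely many rays of the right half-plane, so all partial sums stay in one
fixed sector. -/
theorem exists_norm_powerForm_le (hγ : ∀ j, 0 < (γ j).re) :
    ∃ κ : ℝ, 1 ≤ κ ∧ ∀ (m : Fin n → ℕ+) (j : Fin n),
      ‖powerForm d γ m j‖ ≤ κ * (powerForm d γ m j).re := by
  have h0 : ∀ i, 0 ≤ ‖γ i‖ / (γ i).re := fun i => div_nonneg (norm_nonneg _) (hγ i).le
  refine ⟨1 + ∑ i, ‖γ i‖ / (γ i).re, by linarith [Finset.sum_nonneg fun i (_ : i ∈ Finset.univ) => h0 i],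
    fun m j => ?_⟩
  rw [powerForm_re, powerForm, Finset.mul_sum]
  refine (norm_sum_le _ _).trans (Finset.sum_le_sum fun i _ => ?_)
  rw [norm_mul, norm_pow, Complex.norm_natCast, ← mul_assoc]
  gcongr
  rw [← div_le_iff₀ (hγ i)]
  have := Finset.single_le_sum (fun i _ => h0 i) (Finset.mem_univ i)
  linarith

theorem exists_le_powerForm_re (hγ : ∀ j, 0 < (γ j).re) :
    ∃ g : ℝ, 0 < g ∧ g ≤ 1 ∧ ∀ (m : Fin n → ℕ+) (j : Fin n), g ≤ (powerForm d γ m j).re := by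
  have h1 : ∃ g : ℝ, 0 < g ∧ g ≤ 1 ∧ ∀ i, g ≤ (γ i).re := by
    have h : ∀ᶠ g in 𝓝[>] (0 : ℝ), g ≤ 1 ∧ ∀ i, g ≤ (γ i).re :=
      nhdsWithin_le_nhds (Filter.Eventually.and (Iic_mem_nhds one_pos)
        (eventually_all.2 fun i => Iic_mem_nhds (hγ i)))
    obtain ⟨g, h1, h2⟩ := (h.and self_mem_nhdsWithin).exists
    exact ⟨g, h2, h1.1, h1.2⟩
  obtain ⟨g, hg0, hg1, hg⟩ := h1
  refine ⟨g, hg0, hg1, fun m j => ?_⟩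
  rw [powerForm_re]
  have h2 : (γ j).re * ((m j : ℕ) : ℝ) ^ d j ≤ ∑ i ∈ Finset.Iic j, (γ i).re * ((m i : ℕ) : ℝ) ^ d i :=
    Finset.single_le_sum (f := fun i => (γ i).re * ((m i : ℕ) : ℝ) ^ d i)
      (fun i _ => mul_nonneg (hγ i).le (by positivity)) (Finset.mem_Iic.2 le_rfl)
  have h3 : (1 : ℝ) ≤ ((m j : ℕ) : ℝ) ^ d j := one_le_pow₀ (by exact_mod_cast (m j).pos)
  nlinarith [hg j, hγ j]

theorem multiZetaTerm_eq_prod (s : Fin n → ℂ) (m : Fin n → ℕ+) :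
    multiZetaTerm d γ s m = ∏ j, powerForm d γ m j ^ (-s j) := by
  rw [multiZetaTerm, one_div, ← Finset.prod_inv_distrib]
  refine Finset.prod_congr rfl fun j _ => ?_
  rw [Complex.cpow_neg, powerForm]

/-- In a fixed sector a complex power is comparable to the same power of the real part, since the
argument is bounded. This reduces convergence to the real series. -/
theorem norm_cpow_neg_le {z : ℂ} {κ : ℝ} (hz : 0 < z.re) (hκ : 1 ≤ κ) (h : ‖z‖ ≤ κ * z.re) (s : ℂ) :
    ‖z ^ (-s)‖ ≤ κ ^ |s.re| * Real.exp (Real.pi * |s.im|) * z.re ^ (-s.re) := by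
  have hz0 : z ≠ 0 := fun h => by rw [h] at hz; simp at hz
  have hzn : z.re ≤ ‖z‖ := (le_abs_self _).trans (Complex.abs_re_le_norm z)
  rw [Complex.norm_cpow_of_ne_zero hz0, div_eq_mul_inv, ← Real.exp_neg, mul_right_comm]
  gcongr ?_ * ?_
  · have h1 : ‖z‖ = (‖z‖ / z.re) * z.re := by field_simp
    have h2 : 1 ≤ ‖z‖ / z.re := by rwa [one_le_div hz]
    rw [h1, Real.mul_rpow (by positivity) hz.le, Complex.neg_re]
    gcongr ?_ * _
    calc (‖z‖ / z.re) ^ (-s.re) ≤ (‖z‖ / z.re) ^ |s.re| :=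
          Real.rpow_le_rpow_of_exponent_le h2 (neg_le_abs _)
      _ ≤ κ ^ |s.re| := by
          gcongr
          rwa [div_le_iff₀ hz]
  · rw [Complex.neg_im, mul_neg, neg_neg]
    refine Real.exp_le_exp.2 ((le_abs_self _).trans ?_)
    rw [abs_mul]
    gcongr
    exact Complex.abs_arg_le_pi z

theorem exists_norm_multiZetaTerm_le (hγ : ∀ j, 0 < (γ j).re) (s : Fin n → ℂ) :
    ∃ C : ℝ, 0 ≤ C ∧ ∀ m : Fin n → ℕ+,
      ‖multiZetaTerm d γ s m‖ ≤ C * ∏ j, (powerForm d γ m j).re ^ (-(s j).re) := by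
  obtain ⟨κ, hκ1, hκ⟩ := exists_norm_powerForm_le (d := d) hγ
  refine ⟨∏ j, (κ ^ |(s j).re| * Real.exp (Real.pi * |(s j).im|)), by positivity, fun m => ?_⟩
  rw [multiZetaTerm_eq_prod, norm_prod, ← Finset.prod_mul_distrib]
  exact Finset.prod_le_prod (fun _ _ => norm_nonneg _) fun j _ =>
    norm_cpow_neg_le (powerForm_re_pos hγ m j) hκ1 (hκ m j) (s j)

end powerForm

theorem summable_multiZetaTerm {n : ℕ} {d : Fin (n + 1) → ℕ} (hd : ∀ j, 0 < d j)
    {γ : Fin (n + 1) → ℂ} (hγ : ∀ j, 0 < (γ j).re) {s : Fin (n + 1) → ℂ}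
    (hs : s ∈ convergenceDomain d) : Summable (multiZetaTerm d γ s) := by
  obtain ⟨C, -, hC⟩ := exists_norm_multiZetaTerm_le (d := d) hγ s
  refine Summable.of_norm_bounded (Summable.mul_left C ?_) hC
  simp_rw [powerForm_re]
  refine summable_prod_rpow_neg d hd _ hγ _ fun j => ?_
  simpa [Complex.re_sum] using hs j

section step

variable {n : ℕ} {d : Fin (n + 2) → ℕ} {γ : Fin (n + 2) → ℂ}

theorem powerForm_castSucc (m : Fin (n + 2) → ℕ+) (j : Fin (n + 1)) :
    powerForm d γ m j.castSucc = powerForm (Fin.init d) (Fin.init γ) (Fin.init m) j := by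
  rw [powerForm, Fin.sum_Iic_castSucc]; rfl

theorem powerForm_last (m : Fin (n + 2) → ℕ+) :
    powerForm d γ m (Fin.last (n + 1)) =
      powerForm (Fin.init d) (Fin.init γ) (Fin.init m) (Fin.last n) +
        γ (Fin.last (n + 1)) * ((m (Fin.last (n + 1)) : ℕ) : ℂ) ^ d (Fin.last (n + 1)) := by
  rw [powerForm, Fin.sum_Iic_last]; rfl

theorem multiZetaTerm_succ (s : Fin (n + 2) → ℂ) (m : Fin (n + 2) → ℕ+) :
    multiZetaTerm d γ s m = multiZetaTerm (Fin.init d) (Fin.init γ) (Fin.init s) (Fin.init m) *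
      (powerForm (Fin.init d) (Fin.init γ) (Fin.init m) (Fin.last n) +
        γ (Fin.last (n + 1)) * ((m (Fin.last (n + 1)) : ℕ) : ℂ) ^ d (Fin.last (n + 1))) ^
          (-s (Fin.last (n + 1))) := by
  rw [multiZetaTerm_eq_prod, multiZetaTerm_eq_prod, Fin.prod_univ_castSucc, powerForm_last]
  simp_rw [powerForm_castSucc]
  rfl

end step

/-- This closes the recursion: a power of the last partial sum, produced by integrating out the next
variable, is absorbed into the last exponent. -/
theorem multiZetaTerm_tailShift {n : ℕ} {d : Fin (n + 1) → ℕ} {γ : Fin (n + 1) → ℂ}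
    (hγ : ∀ j, 0 < (γ j).re) (s : Fin (n + 2) → ℂ) (c : ℂ) (m : Fin (n + 1) → ℕ+) :
    multiZetaTerm d γ (tailShift s c) m = multiZetaTerm d γ (Fin.init s) m *
      powerForm d γ m (Fin.last n) ^ (-(s (Fin.last (n + 1)) + c)) := by
  rw [multiZetaTerm_eq_prod, multiZetaTerm_eq_prod]
  have : ∀ j, powerForm d γ m j ^ (-tailShift s c j) = powerForm d γ m j ^ (-Fin.init s j) *
      (if j = Fin.last n then powerForm d γ m (Fin.last n) ^ (-(s (Fin.last (n + 1)) + c)) else 1) := by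
    intro j
    rw [tailShift, neg_add, Complex.cpow_add _ _ (powerForm_ne_zero hγ m j)]
    split_ifs with h
    · rw [h]; rfl
    · simp [Fin.init]
  simp_rw [this, Finset.prod_mul_distrib]
  simp

end

/-! ### Summation over the last variable by Mellin transform. -/

noncomputable section

open MeasureTheory Set

theorem continuousOn_ofReal_cpow_const (s : ℂ) :
    ContinuousOn (fun t : ℝ => (t : ℂ) ^ s) (Ioi 0) := fun t ht =>
  (Complex.continuousAt_ofReal_cpow_const t s (Or.inr (ne_of_gt ht))).continuousWithinAt

theorem aestronglyMeasurable_powerTheta {d : ℕ} (hd : 0 < d) {c : ℂ} (hc : 0 < c.re) :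
    AEStronglyMeasurable (powerTheta d c) (volume.restrict (Ioi 0)) := by
  refine aestronglyMeasurable_of_tendsto_ae atTop
    (f := fun (s : Finset ℕ) (t : ℝ) => ∑ m ∈ s, Complex.exp (-(t * (c * ((m : ℂ) + 1) ^ d))))
    (fun s => Continuous.aestronglyMeasurable (by fun_prop)) ?_
  exact (ae_restrict_iff' measurableSet_Ioi).2 (Eventually.of_forall fun t ht =>
    (summable_exp_neg_mul_pow hd hc ht).hasSum)

theorem aestronglyMeasurable_thetaRemainder {d : ℕ} (hd : 0 < d) {c : ℂ} (hc : 0 < c.re) (K : ℕ) :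
    AEStronglyMeasurable (thetaRemainder d c K) (volume.restrict (Ioi 0)) := by
  refine ((aestronglyMeasurable_powerTheta hd hc).sub
    (((continuousOn_ofReal_cpow_const _).aestronglyMeasurable measurableSet_Ioi).const_mul _)).sub
    (Continuous.aestronglyMeasurable (by fun_prop))

/-- The truncated Mellin transform `∫ t^{s-1} e^{-ta} ψ_K(t) dt`. -/
def mellinRemainder (d : ℕ) (c : ℂ) (K : ℕ) (a s : ℂ) : ℂ :=
  ∫ t in Ioi (0 : ℝ), (t : ℂ) ^ (s - 1) * Complex.exp (-(t * a)) * thetaRemainder d c K t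

theorem integrableOn_mul_thetaRemainder {d : ℕ} (hd : 0 < d) {c : ℂ} (hc : 0 < c.re) {K : ℕ}
    {a s : ℂ} (ha : 0 < a.re) (hs : 0 < (s + K).re) :
    IntegrableOn (fun t : ℝ => (t : ℂ) ^ (s - 1) * Complex.exp (-(t * a)) *
      thetaRemainder d c K t) (Ioi 0) := by
  obtain ⟨C, hC0, hC⟩ := exists_norm_thetaRemainder_le hd hc K
  refine Integrable.mono' ((integrableOn_cpow_mul_exp_neg hs ha).norm.const_mul C) ?_ ?_
  · refine AEStronglyMeasurable.mul (ContinuousOn.aestronglyMeasurable ?_ measurableSet_Ioi)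
      (aestronglyMeasurable_thetaRemainder hd hc K)
    exact (continuousOn_ofReal_cpow_const _).mul (by fun_prop)
  · refine (ae_restrict_iff' measurableSet_Ioi).2 (Eventually.of_forall fun t ht => ?_)
    have ht : 0 < t := ht
    rw [norm_mul, norm_mul, norm_mul, show s + K - 1 = s - 1 + K by ring,
      Complex.cpow_add _ _ (Complex.ofReal_ne_zero.2 ht.ne'), Complex.cpow_natCast, norm_mul, norm_pow,
      Complex.norm_real, Real.norm_of_nonneg ht.le]
    calc _ ≤ ‖(t : ℂ) ^ (s - 1)‖ * ‖Complex.exp (-(t * a))‖ * (C * t ^ K) := by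
          gcongr; exact hC t ht
      _ = _ := by ring

/-- Consecutive remainders differ by a multiple of `t^K`, whose transform is Euler's integral. -/
theorem mellinRemainder_eq_succ {d : ℕ} (hd : 0 < d) {c : ℂ} (hc : 0 < c.re) {K : ℕ}
    {a s : ℂ} (ha : 0 < a.re) (hs : 0 < (s + K).re) :
    mellinRemainder d c K a s = mellinRemainder d c (K + 1) a s +
      (negZeta d K : ℂ) * ((-c) ^ K / K.factorial) * (Complex.Gamma (s + K) * a ^ (-(s + K))) := by
  have hs' : 0 < (s + (K + 1 : ℕ)).re := by
    simp only [Complex.add_re, Complex.natCast_re, Nat.cast_succ, Complex.one_re] at hs ⊢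
    linarith
  rw [← integral_cpow_mul_exp_neg hs ha, ← integral_const_mul, mellinRemainder, mellinRemainder,
    ← integral_add (integrableOn_mul_thetaRemainder hd hc ha hs')
      ((integrableOn_cpow_mul_exp_neg hs ha).const_mul _)]
  refine setIntegral_congr_fun measurableSet_Ioi fun t ht => ?_
  have ht : 0 < t := ht
  rw [show s + K - 1 = s - 1 + K by ring,
      Complex.cpow_add _ _ (Complex.ofReal_ne_zero.2 ht.ne'), Complex.cpow_natCast]
  simp only [thetaRemainder, Finset.sum_range_succ]
  ring

/-- Each summand is an Euler integral; sum and integral are exchanged by absolute convergence, and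
the `t^(-1/d)` part of the theta series is integrated separately. -/
theorem hasSum_add_mul_pow_cpow {d : ℕ} (hd : 0 < d) {c : ℂ} (hc : 0 < c.re) {a s : ℂ}
    (ha : 0 < a.re) (hs : 1 / (d : ℝ) < s.re) :
    HasSum (fun m : ℕ+ => (a + c * ((m : ℕ) : ℂ) ^ d) ^ (-s))
      ((Complex.Gamma s)⁻¹ * (mellinRemainder d c 0 a s + thetaConst d c *
        (Complex.Gamma (s - 1 / d) * a ^ (-(s - 1 / d))))) := by
  have hd0 : 0 < 1 / (d : ℝ) := by positivity
  have hs0 : 0 < s.re := hd0.trans hs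
  have hs1 : 0 < (s - 1 / d).re := by
    have : ((1 : ℂ) / d).re = 1 / d := by
      rw [show (1 : ℂ) / d = ((1 / d : ℝ) : ℂ) by push_cast; rfl, Complex.ofReal_re]
    rw [Complex.sub_re, this]; linarith
  have hre : ∀ m : ℕ, (a + c * ((m : ℂ) + 1) ^ d).re = a.re + c.re * ((m : ℝ) + 1) ^ d := fun m => by
    have : ((m : ℂ) + 1) ^ d = (((m : ℝ) + 1) ^ d : ℝ) := by push_cast; rfl
    rw [this, Complex.add_re, Complex.re_mul_ofReal]
  have hpos : ∀ m : ℕ, 0 < (a + c * ((m : ℂ) + 1) ^ d).re := fun m => by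
    rw [hre]; positivity
  have hF : ∀ m : ℕ, IntegrableOn (fun t : ℝ => (t : ℂ) ^ (s - 1) *
      Complex.exp (-(t * (a + c * ((m : ℂ) + 1) ^ d)))) (Ioi 0) := fun m =>
    integrableOn_cpow_mul_exp_neg hs0 (hpos m)
  have hnorm : ∀ m : ℕ, ∫ t in Ioi (0 : ℝ), ‖(t : ℂ) ^ (s - 1) *
      Complex.exp (-(t * (a + c * ((m : ℂ) + 1) ^ d)))‖ =
      Real.Gamma s.re * (a.re + c.re * ((m : ℝ) + 1) ^ d) ^ (-s.re) := fun m => by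
    have h := Real.integral_rpow_mul_exp_neg_mul_Ioi hs0 (hpos m)
    rw [one_div, Real.inv_rpow (hpos m).le, ← Real.rpow_neg (hpos m).le,
      mul_comm (_ ^ (-s.re)), hre] at h
    rw [← h]
    refine setIntegral_congr_fun measurableSet_Ioi fun t ht => ?_
    have ht : 0 < t := ht
    rw [norm_mul, Complex.norm_cpow_eq_rpow_re_of_pos ht, Complex.norm_exp, Complex.neg_re,
      Complex.re_ofReal_mul, hre, mul_comm t]
    simp
  have hsum := hasSum_integral_of_summable_integral_norm hF (by
    simp_rw [hnorm]
    refine Summable.mul_left _ ?_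
    have h1 := summable_pnat_rpow hd hc hs
    rw [← Equiv.pnatEquivNat.symm.summable_iff] at h1
    refine Summable.of_nonneg_of_le (fun m => by positivity) (fun m => ?_) h1
    simp only [Function.comp_apply, Equiv.pnatEquivNat_symm_apply, Nat.succPNat_coe, Nat.succ_eq_add_one]
    push_cast
    exact Real.rpow_le_rpow_of_nonpos (by positivity) (by linarith) (by linarith))
  simp_rw [integral_cpow_mul_exp_neg hs0 (hpos _)] at hsum
  have hint : ∫ t in Ioi (0 : ℝ), ∑' m : ℕ, (t : ℂ) ^ (s - 1) *
      Complex.exp (-(t * (a + c * ((m : ℂ) + 1) ^ d))) =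
      mellinRemainder d c 0 a s + thetaConst d c *
        (Complex.Gamma (s - 1 / d) * a ^ (-(s - 1 / d))) := by
    rw [← integral_cpow_mul_exp_neg hs1 ha, ← integral_const_mul, mellinRemainder,
      ← integral_add (integrableOn_mul_thetaRemainder hd hc ha (by simpa using hs0))
        ((integrableOn_cpow_mul_exp_neg hs1 ha).const_mul _)]
    refine setIntegral_congr_fun measurableSet_Ioi fun t ht => ?_
    have ht : 0 < t := ht
    rw [show s - 1 / d - 1 = s - 1 + -(1 / d) by ring,
      Complex.cpow_add _ _ (Complex.ofReal_ne_zero.2 ht.ne')]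
    have : ∀ m : ℕ, (t : ℂ) ^ (s - 1) * Complex.exp (-(t * (a + c * ((m : ℂ) + 1) ^ d))) =
        (t : ℂ) ^ (s - 1) * Complex.exp (-(t * a)) *
          Complex.exp (-(t * (c * ((m : ℂ) + 1) ^ d))) := fun m => by
      rw [mul_assoc, ← Complex.exp_add]; ring_nf
    simp_rw [this]
    rw [tsum_mul_left, thetaRemainder, powerTheta]
    simp only [Finset.range_zero, Finset.sum_empty]
    ring
  rw [hint] at hsum
  have h2 := hsum.mul_left (Complex.Gamma s)⁻¹
  have hG := Complex.Gamma_ne_zero_of_re_pos hs0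
  rw [← Equiv.pnatEquivNat.symm.hasSum_iff]
  refine h2.congr_fun fun m => ?_
  rw [inv_mul_cancel_left₀ hG]
  simp

/-- Valid at the poles too: `Complex.Gamma` takes the value `0` there, so its inverse is `0`, and
the Pochhammer polynomial vanishes as `hs` forces `k < K`. -/
theorem Complex.Gamma_inv_mul_Gamma_add_natCast {s : ℂ} {K : ℕ} (hs : 0 < (s + K).re) :
    (Complex.Gamma s)⁻¹ * Complex.Gamma (s + K) = (ascPochhammer ℂ K).eval s := by
  by_cases h : ∀ k : ℕ, s ≠ -k
  · rw [← Complex.Gamma_add_nat_div_Gamma_eq s h, div_eq_mul_inv, mul_comm]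
  · push Not at h
    obtain ⟨k, rfl⟩ := h
    have hk : k < K := by
      simp only [Complex.add_re, Complex.neg_re, Complex.natCast_re] at hs
      exact_mod_cast (by linarith : (k : ℝ) < K)
    rw [Complex.Gamma_neg_nat_eq_zero, inv_zero, zero_mul]
    exact ((ascPochhammer_eval_eq_zero_iff _ _).2 ⟨k, hk, by simp⟩).symm

/-- The discrete structure lets sums over tuples be integrals against counting measure. -/
instance : MeasurableSpace ℕ+ := ⊤

instance : MeasurableSingletonClass ℕ+ := ⟨fun _ => trivial⟩

/-- Tonelli: the inner integral over `t` is `Γ(a) b^(-a)`. -/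
theorem integrable_count_prod_rpow_mul_exp {ι : Type*} [Countable ι] [MeasurableSpace ι]
    [MeasurableSingletonClass ι] {A b : ι → ℝ} (hA : ∀ m, 0 ≤ A m) (hb : ∀ m, 0 < b m) {a : ℝ}
    (ha : 0 < a) (h : Summable fun m => A m * b m ^ (-a)) :
    Integrable (fun ω : ι × ℝ => A ω.1 * (ω.2 ^ (a - 1) * Real.exp (-(b ω.1 * ω.2))))
      (Measure.count.prod (volume.restrict (Ioi 0))) := by
  refine (integrable_prod_iff ?_).2 ⟨Eventually.of_forall fun m => ?_, ?_⟩
  · refine Measurable.aestronglyMeasurable (measurable_from_prod_countable_right fun m => ?_)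
    fun_prop
  · have := integrableOn_rpow_mul_exp_neg_mul_rpow (p := 1) (s := a - 1) (by linarith)
      one_pos (hb m)
    simp only [Real.rpow_one, neg_mul] at this
    exact Integrable.const_mul this (A m)
  · have : ∀ m, ∫ t in Ioi (0 : ℝ), ‖A m * (t ^ (a - 1) * Real.exp (-(b m * t)))‖ =
        A m * b m ^ (-a) * Real.Gamma a := fun m => by
      rw [Real.rpow_neg (hb m).le, ← Real.inv_rpow (hb m).le, ← one_div, mul_assoc,
        ← Real.integral_rpow_mul_exp_neg_mul_Ioi ha (hb m), ← integral_const_mul]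
      refine setIntegral_congr_fun measurableSet_Ioi fun t ht => ?_
      have ht : 0 < t := ht
      have := hA m
      exact Real.norm_of_nonneg (by positivity)
    simp_rw [this]
    exact integrable_count_iff.2 (h.mul_right _).norm

end

/-! ### Holomorphy of the summed remainder. -/

noncomputable section

open MeasureTheory Set

theorem hasSum_integral_count {ι : Type*} [Countable ι] [MeasurableSpace ι]
    [MeasurableSingletonClass ι] {f : ι → ℂ} (h : Integrable f Measure.count) :
    HasSum f (∫ m, f m ∂Measure.count) := by
  have h3 : ∫ m, f m ∂Measure.count = ∑' m, f m := by
    rw [integral_countable h]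
    simp [Measure.real]
  rw [h3]
  exact (integrable_count_iff.1 h).of_norm.hasSum

theorem Complex.norm_log_le_add_pi (z : ℂ) : ‖Complex.log z‖ ≤ |Real.log ‖z‖| + Real.pi := by
  refine (Complex.norm_le_abs_re_add_abs_im _).trans ?_
  rw [Complex.log_re, Complex.log_im]
  gcongr
  exact Complex.abs_arg_le_pi z

/-- Converts the perturbation weight in the variable `t` into two ordinary powers. -/
theorem Real.exp_mul_abs_log_le {t r : ℝ} (ht : 0 < t) :
    Real.exp (r * |Real.log t|) ≤ t ^ r + t ^ (-r) := by
  rw [Real.rpow_def_of_pos ht, Real.rpow_def_of_pos ht]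
  rcases abs_cases (Real.log t) with ⟨h, -⟩ | ⟨h, -⟩ <;> rw [h]
  · rw [mul_comm r]
    linarith [Real.exp_pos (Real.log t * -r)]
  · rw [show r * -Real.log t = Real.log t * -r by ring]
    linarith [Real.exp_pos (Real.log t * r)]

/-- Makes the perturbation weight cost only a constant times the `r`-th power of the real part. The
uniform lower bound on the real parts removes the absolute value of the logarithm. -/
theorem exists_norm_log_powerForm_le {n : ℕ} {d : Fin n → ℕ} {γ : Fin n → ℂ}
    (hγ : ∀ j, 0 < (γ j).re) : ∃ C : ℝ, ∀ (m : Fin n → ℕ+) (j : Fin n),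
      ‖Complex.log (powerForm d γ m j)‖ ≤ Real.log (powerForm d γ m j).re + C := by
  obtain ⟨κ, hκ1, hκ⟩ := exists_norm_powerForm_le (d := d) hγ
  obtain ⟨g, hg0, hg1, hg⟩ := exists_le_powerForm_re (d := d) hγ
  refine ⟨Real.log κ - 2 * Real.log g + Real.pi, fun m j => ?_⟩
  have hb := powerForm_re_pos (d := d) hγ m j
  have hκ0 : 0 < κ := by linarith
  have h1 : (powerForm d γ m j).re ≤ ‖powerForm d γ m j‖ :=
    (le_abs_self _).trans (Complex.abs_re_le_norm _)
  have h2 := Real.log_le_log hb h1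
  have h3 := Real.log_le_log (hb.trans_le h1) (hκ m j)
  rw [Real.log_mul hκ0.ne' hb.ne'] at h3
  have h4 := Real.log_le_log hg0 (hg m j)
  have h5 := Real.log_nonpos hg0.le hg1
  have h6 := Real.log_nonneg hκ1
  have h7 : |Real.log ‖powerForm d γ m j‖| ≤
      Real.log (powerForm d γ m j).re + (Real.log κ - 2 * Real.log g) :=
    abs_le.2 ⟨by linarith, by linarith⟩
  linarith [Complex.norm_log_le_add_pi (powerForm d γ m j)]

section

variable {n : ℕ} (d : Fin (n + 2) → ℕ) (γ : Fin (n + 2) → ℂ) (K : ℕ)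

/-- The region in which the expansion of order `K` in the last variable applies. -/
def remainderDomain : Set (Fin (n + 2) → ℂ) :=
  {s | 0 < (s (Fin.last (n + 1)) + K).re ∧ tailShift s (K : ℂ) ∈ convergenceDomain (Fin.init d)}

/-- The integrand, over tuples and `t > 0`, of the remainder of order `K`. -/
def remainderIntegrand (s : Fin (n + 2) → ℂ) (ω : (Fin (n + 1) → ℕ+) × ℝ) : ℂ :=
  multiZetaTerm (Fin.init d) (Fin.init γ) (Fin.init s) ω.1 *
    ((ω.2 : ℂ) ^ (s (Fin.last (n + 1)) - 1) *
      Complex.exp (-(ω.2 * powerForm (Fin.init d) (Fin.init γ) ω.1 (Fin.last n))) *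
      thetaRemainder (d (Fin.last (n + 1))) (γ (Fin.last (n + 1))) K ω.2)

/-- The factor of `remainderIntegrand` which does not depend on `s`. -/
def remainderWeight (ω : (Fin (n + 1) → ℕ+) × ℝ) : ℂ :=
  (ω.2 : ℂ)⁻¹ * Complex.exp (-(ω.2 * powerForm (Fin.init d) (Fin.init γ) ω.1 (Fin.last n))) *
    thetaRemainder (d (Fin.last (n + 1))) (γ (Fin.last (n + 1))) K ω.2

/-- The exponents of `remainderIntegrand` as a function of `s`. -/
def remainderExponent (ω : (Fin (n + 1) → ℕ+) × ℝ) : Fin (n + 2) → ℂ :=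
  Fin.snoc (α := fun _ => ℂ)
    (fun j => -Complex.log (powerForm (Fin.init d) (Fin.init γ) ω.1 j)) (Complex.log ω.2)

variable {d γ K}

/-- Puts the integrand in the form required by `analyticAt_integral_exp_of_integrable`, with
logarithms as exponents. -/
theorem remainderWeight_mul_exp (hγ : ∀ j, 0 < (γ j).re) (s : Fin (n + 2) → ℂ)
    {ω : (Fin (n + 1) → ℕ+) × ℝ} (ht : 0 < ω.2) :
    remainderWeight d γ K ω * Complex.exp (∑ i, s i * remainderExponent d γ ω i) =
      remainderIntegrand d γ K s ω := by
  have ht' : (ω.2 : ℂ) ≠ 0 := Complex.ofReal_ne_zero.2 ht.ne'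
  rw [Fin.sum_univ_castSucc, Complex.exp_add, Complex.exp_sum, remainderWeight, remainderIntegrand,
    multiZetaTerm_eq_prod, Complex.cpow_sub _ _ ht', Complex.cpow_one, Complex.cpow_def_of_ne_zero ht']
  have : ∀ j : Fin (n + 1), Complex.exp (s j.castSucc * remainderExponent d γ ω j.castSucc) =
      powerForm (Fin.init d) (Fin.init γ) ω.1 j ^ (-Fin.init s j) := fun j => by
    rw [Complex.cpow_def_of_ne_zero (powerForm_ne_zero (γ := Fin.init γ) (fun j => hγ _) _ _), remainderExponent,
      Fin.snoc_castSucc]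
    congr 1
    simp only [Fin.init]
    ring
  simp_rw [this, remainderExponent, Fin.snoc_last, div_eq_mul_inv, mul_comm (s (Fin.last (n + 1)))]
  ring

theorem aestronglyMeasurable_remainderWeight (hd : ∀ j, 0 < d j) (hγ : ∀ j, 0 < (γ j).re) :
    AEStronglyMeasurable (remainderWeight d γ K)
      (Measure.count.prod (volume.restrict (Ioi 0))) := by
  refine AEStronglyMeasurable.mul ?_
    (aestronglyMeasurable_thetaRemainder (hd _) (hγ _) K).comp_snd
  refine Measurable.aestronglyMeasurable (measurable_from_prod_countable_right fun m => ?_)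
  fun_prop

theorem aestronglyMeasurable_remainderExponent (i : Fin (n + 2)) :
    AEStronglyMeasurable (fun ω => remainderExponent d γ ω i)
      (Measure.count.prod (volume.restrict (Ioi 0))) := by
  refine Measurable.aestronglyMeasurable (measurable_from_prod_countable_right fun m => ?_)
  induction i using Fin.lastCases with
  | last =>
    simp only [remainderExponent, Fin.snoc_last]
    fun_prop
  | cast j =>
    simp only [remainderExponent, Fin.snoc_castSucc]
    fun_prop

theorem ae_snd_pos {ι : Type*} [MeasurableSpace ι] {μ : Measure ι} :
    ∀ᵐ ω : ι × ℝ ∂(μ.prod (volume.restrict (Ioi 0))), 0 < ω.2 :=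
  Measure.quasiMeasurePreserving_snd.ae (ae_restrict_mem measurableSet_Ioi)

/-- The defining inequalities are strict, so there is room to lower every exponent by some `r > 0`;
this is the radius of holomorphy. -/
theorem exists_summable_shifted (hd : ∀ j, 0 < d j) (hγ : ∀ j, 0 < (γ j).re)
    {s : Fin (n + 2) → ℂ} (hs : s ∈ remainderDomain d K) :
    ∃ r : ℝ, 0 < r ∧ r < (s (Fin.last (n + 1)) + K).re ∧ ∀ c : ℝ, K ≤ c →
      Summable fun m : Fin (n + 1) → ℕ+ =>
        (∏ j : Fin (n + 1), (powerForm (Fin.init d) (Fin.init γ) m j).re ^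
          (-((s j.castSucc).re - r))) *
        (powerForm (Fin.init d) (Fin.init γ) m (Fin.last n)).re ^
          (-((s (Fin.last (n + 1))).re - r + c)) := by
  obtain ⟨hs1, hs2⟩ := hs
  have h : ∀ᶠ r in 𝓝[>] (0 : ℝ), r < (s (Fin.last (n + 1)) + K).re ∧ ∀ j : Fin (n + 1),
      ∑ k ∈ Finset.Ici j, (1 : ℝ) / (Fin.init d : Fin (n + 1) → ℕ) k <
        ∑ k ∈ Finset.Ici j.castSucc, ((s k).re - r) + K := by
    refine nhdsWithin_le_nhds (Filter.Eventually.and (Iio_mem_nhds hs1) (eventually_all.2 fun j => ?_))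
    have h1 := hs2 j
    rw [sum_Ici_tailShift, Complex.add_re, Complex.re_sum, Complex.natCast_re] at h1
    have hc : Continuous fun r : ℝ => ∑ k ∈ Finset.Ici j.castSucc, ((s k).re - r) + (K : ℝ) := by
      fun_prop
    exact (hc.tendsto 0).eventually (lt_mem_nhds (by simpa using h1))
  obtain ⟨r, ⟨h1, h2⟩, h3⟩ := (h.and self_mem_nhdsWithin).exists
  refine ⟨r, h3, h1, fun c hc => ?_⟩
  have h4 := summable_prod_rpow_neg (Fin.init d : Fin (n + 1) → ℕ) (fun j => hd _)
    (fun j => ((Fin.init γ : Fin (n + 1) → ℂ) j).re) (fun j => hγ _)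
    (tailShift (fun k => (s k).re - r) c) (fun j => by
      rw [sum_Ici_tailShift]
      exact (h2 j).trans_le (by gcongr))
  refine h4.congr fun m => ?_
  simp_rw [← powerForm_re]
  exact prod_rpow_neg_tailShift (fun j => powerForm_re_pos (fun j => hγ _) m j) _ _

theorem exists_integrable_remainder (hd : ∀ j, 0 < d j) (hγ : ∀ j, 0 < (γ j).re)
    {s : Fin (n + 2) → ℂ} (hs : s ∈ remainderDomain d K) :
    ∃ r : ℝ, 0 < r ∧ Integrable (fun ω => ‖remainderWeight d γ K ω *
      Complex.exp (∑ i, s i * remainderExponent d γ ω i)‖ *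
        Real.exp (r * ∑ i, ‖remainderExponent d γ ω i‖))
      (Measure.count.prod (volume.restrict (Ioi 0))) := by
  obtain ⟨r, hr0, hr1, hr⟩ := exists_summable_shifted hd hγ hs
  have hγ' : ∀ j, 0 < ((Fin.init γ : Fin (n + 1) → ℂ) j).re := fun j => hγ _
  refine ⟨r, hr0, ?_⟩
  obtain ⟨C₁, hC₁0, hC₁⟩ := exists_norm_multiZetaTerm_le (d := Fin.init d) hγ' (Fin.init s)
  obtain ⟨C₂, hC₂0, hC₂⟩ := exists_norm_thetaRemainder_le (hd (Fin.last (n + 1)))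
    (hγ (Fin.last (n + 1))) K
  obtain ⟨C₃, hC₃⟩ := exists_norm_log_powerForm_le (d := Fin.init d) hγ'
  set β : (Fin (n + 1) → ℕ+) → Fin (n + 1) → ℝ := fun m j =>
    (powerForm (Fin.init d) (Fin.init γ) m j).re with hβ
  have hβ0 : ∀ m j, 0 < β m j := fun m j => powerForm_re_pos hγ' m j
  set σ := (s (Fin.last (n + 1))).re with hσ
  set E : ℝ := C₁ * C₂ * Real.exp (r * C₃) ^ (n + 1) with hE
  have hE0 : 0 ≤ E := by positivity
  set A : (Fin (n + 1) → ℕ+) → ℝ := fun m => E * ∏ j, β m j ^ (-((s j.castSucc).re - r)) with hA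
  have hA0 : ∀ m, 0 ≤ A m := fun m =>
    mul_nonneg hE0 (Finset.prod_nonneg fun j _ => Real.rpow_nonneg (hβ0 m j).le _)
  have hσ0 : r < σ + K := by simpa using hr1
  have hint : ∀ c : ℝ, K ≤ c → Integrable (fun ω : (Fin (n + 1) → ℕ+) × ℝ =>
      A ω.1 * (ω.2 ^ (σ - r + c - 1) * Real.exp (-(β ω.1 (Fin.last n) * ω.2))))
      (Measure.count.prod (volume.restrict (Ioi 0))) := fun c hc => by
    refine integrable_count_prod_rpow_mul_exp hA0 (fun m => hβ0 m _) (by linarith) ?_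
    simp_rw [hA, mul_assoc]
    exact (hr c hc).mul_left E
  -- The weight contributes `t^r + t^(-r)`; relative to the lowered exponent `σ - r` these are the
  -- shifts `K + 2r` and `K`.
  refine Integrable.mono' ((hint (K + 2 * r) (by linarith)).add (hint K le_rfl)) ?_ ?_
  · refine AEStronglyMeasurable.mul (AEStronglyMeasurable.norm
      ((aestronglyMeasurable_remainderWeight hd hγ).mul ?_)) ?_
    · exact Complex.continuous_exp.comp_aestronglyMeasurable
        (Finset.aestronglyMeasurable_fun_sum _ fun i _ =>
          (aestronglyMeasurable_remainderExponent i).const_mul _)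
    · exact Real.continuous_exp.comp_aestronglyMeasurable
        ((Finset.aestronglyMeasurable_fun_sum _ fun i _ =>
          (aestronglyMeasurable_remainderExponent i).norm).const_mul _)
  · filter_upwards [ae_snd_pos] with ω ht
    rw [remainderWeight_mul_exp hγ s ht, norm_mul, Real.norm_of_nonneg (Real.exp_pos _).le, norm_norm,
      remainderIntegrand]
    obtain ⟨m, t⟩ := ω
    simp only at ht ⊢
    have h1 : ‖Complex.exp (-(t * powerForm (Fin.init d) (Fin.init γ) m (Fin.last n)))‖ =
        Real.exp (-(β m (Fin.last n) * t)) := by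
      rw [Complex.norm_exp, Complex.neg_re, Complex.re_ofReal_mul, mul_comm]
    have h2 : Real.exp (r * ∑ i, ‖remainderExponent d γ (m, t) i‖) ≤
        (Real.exp (r * C₃) ^ (n + 1) * ∏ j, β m j ^ r) * (t ^ r + t ^ (-r)) := by
      rw [Fin.sum_univ_castSucc, mul_add, Real.exp_add, Finset.mul_sum, Real.exp_sum]
      have h3 : Real.exp (r * C₃) ^ (n + 1) * ∏ j, β m j ^ r =
          ∏ j : Fin (n + 1), (Real.exp (r * C₃) * β m j ^ r) := by
        rw [Finset.prod_mul_distrib]; simp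
      rw [h3]
      refine mul_le_mul ?_ ?_ (Real.exp_pos _).le (Finset.prod_nonneg fun j _ =>
        mul_nonneg (Real.exp_pos _).le (Real.rpow_nonneg (hβ0 m j).le _))
      · refine Finset.prod_le_prod (fun _ _ => (Real.exp_pos _).le) fun j _ => ?_
        rw [remainderExponent, Fin.snoc_castSucc, norm_neg, Real.rpow_def_of_pos (hβ0 m j),
          ← Real.exp_add]
        refine Real.exp_le_exp.2 ?_
        have := mul_le_mul_of_nonneg_left (hC₃ m j) hr0.le
        linarith
      · rw [remainderExponent, Fin.snoc_last]
        simp only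
        rw [← Complex.ofReal_log ht.le, Complex.norm_real, Real.norm_eq_abs]
        exact Real.exp_mul_abs_log_le ht
    have hp : ∀ j, β m j ^ (-((s j.castSucc).re - r)) = β m j ^ (-(s j.castSucc).re) * β m j ^ r :=
      fun j => by rw [← Real.rpow_add (hβ0 m j)]; ring_nf
    have hP0 : 0 ≤ ∏ j, β m j ^ r := Finset.prod_nonneg fun j _ => Real.rpow_nonneg (hβ0 m j).le _
    have hQ0 : 0 ≤ ∏ j, β m j ^ (-(s j.castSucc).re) :=
      Finset.prod_nonneg fun j _ => Real.rpow_nonneg (hβ0 m j).le _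
    have ht1 : t ^ (σ - r + (K + 2 * r) - 1) = t ^ (σ - 1) * t ^ K * t ^ r := by
      rw [← Real.rpow_natCast, ← Real.rpow_add ht, ← Real.rpow_add ht]; ring_nf
    have ht2 : t ^ (σ - r + K - 1) = t ^ (σ - 1) * t ^ K * t ^ (-r) := by
      rw [← Real.rpow_natCast, ← Real.rpow_add ht, ← Real.rpow_add ht]; ring_nf
    rw [norm_mul, norm_mul, norm_mul, h1, Complex.norm_cpow_eq_rpow_re_of_pos ht, Complex.sub_re,
      Complex.one_re]
    calc _ ≤ C₁ * (∏ j, β m j ^ (-(s j.castSucc).re)) * (t ^ (σ - 1) *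
          Real.exp (-(β m (Fin.last n) * t)) * (C₂ * t ^ K)) *
          ((Real.exp (r * C₃) ^ (n + 1) * ∏ j, β m j ^ r) * (t ^ r + t ^ (-r))) := by
          gcongr
          · exact hC₁ m
          · exact hC₂ t ht
      _ = _ := by
          simp only [Pi.add_apply, ht1, ht2, hA, hp, Finset.prod_mul_distrib, hE]
          ring

variable (d γ K) in
/-- The remainder of order `K`, up to a Gamma factor. -/
def remainderIntegral (s : Fin (n + 2) → ℂ) : ℂ :=
  ∫ ω, remainderIntegrand d γ K s ω ∂(Measure.count.prod (volume.restrict (Ioi 0)))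

theorem analyticAt_remainderIntegral (hd : ∀ j, 0 < d j) (hγ : ∀ j, 0 < (γ j).re)
    {s : Fin (n + 2) → ℂ} (hs : s ∈ remainderDomain d K) :
    AnalyticAt ℂ (remainderIntegral d γ K) s := by
  obtain ⟨r, hr0, hr⟩ := exists_integrable_remainder hd hγ hs
  have h := analyticAt_integral_exp_of_integrable (aestronglyMeasurable_remainderWeight hd hγ)
    aestronglyMeasurable_remainderExponent hr0 hr
  have : remainderIntegral d γ K = fun s => ∫ ω, remainderWeight d γ K ω *
      Complex.exp (∑ i, s i * remainderExponent d γ ω i)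
      ∂(Measure.count.prod (volume.restrict (Ioi 0))) := by
    funext s
    refine integral_congr_ae ?_
    filter_upwards [ae_snd_pos] with ω ht
    rw [remainderWeight_mul_exp hγ s ht]
  rwa [this]

/-- Fubini: integrating over `t` first leaves the Mellin remainders. -/
theorem hasSum_remainderIntegral (hd : ∀ j, 0 < d j) (hγ : ∀ j, 0 < (γ j).re)
    {s : Fin (n + 2) → ℂ} (hs : s ∈ remainderDomain d K) :
    HasSum (fun m => multiZetaTerm (Fin.init d) (Fin.init γ) (Fin.init s) m *
      mellinRemainder (d (Fin.last (n + 1))) (γ (Fin.last (n + 1))) K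
        (powerForm (Fin.init d) (Fin.init γ) m (Fin.last n)) (s (Fin.last (n + 1))))
      (remainderIntegral d γ K s) := by
  obtain ⟨r, hr0, hr⟩ := exists_integrable_remainder hd hγ hs
  have h1 : Integrable (remainderIntegrand d γ K s)
      (Measure.count.prod (volume.restrict (Ioi 0))) := by
    have hm : AEStronglyMeasurable (fun ω => remainderWeight d γ K ω *
        Complex.exp (∑ i, s i * remainderExponent d γ ω i))
        (Measure.count.prod (volume.restrict (Ioi 0))) :=
      (aestronglyMeasurable_remainderWeight hd hγ).mul
        (Complex.continuous_exp.comp_aestronglyMeasurable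
          (Finset.aestronglyMeasurable_fun_sum _ fun i _ =>
            (aestronglyMeasurable_remainderExponent i).const_mul _))
    refine (Integrable.mono' hr hm (Eventually.of_forall fun ω => ?_)).congr ?_
    · exact le_mul_of_one_le_right (norm_nonneg _) (Real.one_le_exp (by positivity))
    · filter_upwards [ae_snd_pos] with ω ht
      exact remainderWeight_mul_exp hγ s ht
  rw [remainderIntegral, integral_prod _ h1]
  refine (hasSum_integral_count h1.integral_prod_left).congr_fun fun m => ?_
  rw [mellinRemainder]
  exact (integral_const_mul _ _).symm

end

end

/-! ### Local quotients of analytic functions, the zeta function, and the polar hyperplanes. -/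

noncomputable section

/-- Near `p`, the function `F` is a quotient of analytic functions whose denominator is nonzero on a
dense subset of a neighbourhood of `p`. -/
def IsQuotientAt {E : Type*} [NormedAddCommGroup E] [NormedSpace ℂ E] (F : E → ℂ) (p : E) : Prop :=
  ∃ g h : E → ℂ, AnalyticAt ℂ g p ∧ AnalyticAt ℂ h p ∧
    (∀ᶠ q in 𝓝 p, ∃ᶠ s in 𝓝 q, h s ≠ 0) ∧ ∀ᶠ s in 𝓝 p, h s ≠ 0 → F s = g s / h s

namespace IsQuotientAt

variable {E : Type*} [NormedAddCommGroup E] [NormedSpace ℂ E] {F G : E → ℂ} {p : E}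

theorem of_analyticAt (hF : AnalyticAt ℂ F p) : IsQuotientAt F p :=
  ⟨F, fun _ => 1, hF, analyticAt_const, Eventually.of_forall fun _ => by simp,
    Eventually.of_forall fun _ => by simp⟩

/-- Nonvanishing near every point close to `p`, not just near `p`, is what multiplies: where `h₁` is
nonzero it stays so nearby, and `h₂` is nonzero at points there. -/
theorem frequently_mul_ne_zero {h₁ h₂ : E → ℂ} (a₁ : AnalyticAt ℂ h₁ p)
    (n₁ : ∀ᶠ q in 𝓝 p, ∃ᶠ s in 𝓝 q, h₁ s ≠ 0) (n₂ : ∀ᶠ q in 𝓝 p, ∃ᶠ s in 𝓝 q, h₂ s ≠ 0) :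
    ∀ᶠ q in 𝓝 p, ∃ᶠ s in 𝓝 q, h₁ s * h₂ s ≠ 0 := by
  filter_upwards [n₁, n₂.eventually_nhds, a₁.eventually_analyticAt.eventually_nhds]
    with q hq₁ hq₂ hq₃
  rw [← frequently_frequently_nhds]
  refine (hq₁.and_eventually (hq₂.and hq₃)).mono fun s ⟨hs₁, hs₂, hs₃⟩ => ?_
  exact (hs₂.and_eventually (hs₃.continuousAt.eventually_ne hs₁)).mono
    fun x hx => mul_ne_zero hx.2 hx.1

theorem mul (hF : IsQuotientAt F p) (hG : IsQuotientAt G p) :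
    IsQuotientAt (fun s => F s * G s) p := by
  obtain ⟨g₁, h₁, ag₁, ah₁, n₁, e₁⟩ := hF
  obtain ⟨g₂, h₂, ag₂, ah₂, n₂, e₂⟩ := hG
  refine ⟨fun s => g₁ s * g₂ s, fun s => h₁ s * h₂ s, ag₁.mul ag₂, ah₁.mul ah₂,
    frequently_mul_ne_zero ah₁ n₁ n₂, ?_⟩
  filter_upwards [e₁, e₂] with s hs₁ hs₂ hs
  rw [hs₁ (left_ne_zero_of_mul hs), hs₂ (right_ne_zero_of_mul hs), div_mul_div_comm]

theorem add (hF : IsQuotientAt F p) (hG : IsQuotientAt G p) :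
    IsQuotientAt (fun s => F s + G s) p := by
  obtain ⟨g₁, h₁, ag₁, ah₁, n₁, e₁⟩ := hF
  obtain ⟨g₂, h₂, ag₂, ah₂, n₂, e₂⟩ := hG
  refine ⟨fun s => g₁ s * h₂ s + h₁ s * g₂ s, fun s => h₁ s * h₂ s,
    (ag₁.mul ah₂).add (ah₁.mul ag₂), ah₁.mul ah₂, frequently_mul_ne_zero ah₁ n₁ n₂, ?_⟩
  filter_upwards [e₁, e₂] with s hs₁ hs₂ hs
  rw [hs₁ (left_ne_zero_of_mul hs), hs₂ (right_ne_zero_of_mul hs),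
    div_add_div _ _ (left_ne_zero_of_mul hs) (right_ne_zero_of_mul hs)]

theorem sum {ι : Type*} (S : Finset ι) {F : ι → E → ℂ} (hF : ∀ i ∈ S, IsQuotientAt (F i) p) :
    IsQuotientAt (fun s => ∑ i ∈ S, F i s) p := by
  classical
  induction S using Finset.induction_on with
  | empty => simpa using of_analyticAt (analyticAt_const (v := (0 : ℂ)))
  | insert i S hi ih =>
    simp_rw [Finset.sum_insert hi]
    exact (hF i (Finset.mem_insert_self _ _)).add
      (ih fun j hj => hF j (Finset.mem_insert_of_mem hj))

theorem congr (hF : IsQuotientAt F p) (h : F =ᶠ[𝓝 p] G) : IsQuotientAt G p := by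
  obtain ⟨g₁, h₁, ag₁, ah₁, n₁, e₁⟩ := hF
  refine ⟨g₁, h₁, ag₁, ah₁, n₁, ?_⟩
  filter_upwards [e₁, h] with s hs₁ hs₂ hs
  rw [← hs₂, hs₁ hs]

/-- Openness of `A` ensures that the pulled-back denominator is still nonzero at points arbitrarily
close to any given one. -/
theorem comp {E' : Type*} [NormedAddCommGroup E'] [NormedSpace ℂ E'] {A : E' → E} {x : E'}
    (hF : IsQuotientAt F (A x)) (hA : AnalyticAt ℂ A x) (hA' : IsOpenMap A) :
    IsQuotientAt (fun s => F (A s)) x := by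
  obtain ⟨g₁, h₁, ag₁, ah₁, n₁, e₁⟩ := hF
  refine ⟨fun s => g₁ (A s), fun s => h₁ (A s), ag₁.fun_comp hA, ah₁.fun_comp hA, ?_,
    hA.continuousAt.eventually e₁⟩
  filter_upwards [hA.continuousAt.eventually n₁] with q hq
  exact hq.filter_mono (hA'.nhds_le q)

theorem of_meromorphicAt {f : ℂ → ℂ} {x : ℂ} (hf : MeromorphicAt f x) : IsQuotientAt f x := by
  obtain ⟨k, hk⟩ := hf
  refine ⟨_, fun z => (z - x) ^ k, hk, by fun_prop, Eventually.of_forall fun q => ?_,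
    Eventually.of_forall fun z hz => ?_⟩
  · have h : ∃ᶠ z in 𝓝 q, z ≠ x := mem_closure_iff_frequently.1 (dense_compl_singleton x q)
    exact h.mono fun z hz => pow_ne_zero _ (sub_ne_zero.2 hz)
  · rw [smul_eq_mul, mul_div_cancel_left₀ _ hz]

theorem isMeromorphicOnSpace {n : ℕ} {F : (Fin n → ℂ) → ℂ} (hF : ∀ p, IsQuotientAt F p) :
    IsMeromorphicOnSpace F := fun p => by
  obtain ⟨g, h, ag, ah, n, e⟩ := hF p
  exact ⟨g, h, ag, ah, n.self_of_nhds, e⟩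

end IsQuotientAt

theorem analyticAt_riemannZeta {z : ℂ} (hz : z ≠ 1) : AnalyticAt ℂ riemannZeta z :=
  DifferentiableOn.analyticAt (s := {1}ᶜ)
    (fun _ hw => (differentiableAt_riemannZeta hw).differentiableWithinAt)
    (isOpen_compl_singleton.mem_nhds hz)

/-- At `1`, the product `(z - 1) ζ(z)` has a removable singularity with value `1`. -/
theorem meromorphicAt_riemannZeta (s : ℂ) : MeromorphicAt riemannZeta s := by
  rcases eq_or_ne s 1 with rfl | hs
  · have h1 : AnalyticAt ℂ (Function.update (fun z => (z - 1) * riemannZeta z) 1 1) 1 := by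
      refine Complex.analyticAt_of_differentiable_on_punctured_nhds_of_continuousAt ?_ ?_
      · filter_upwards [self_mem_nhdsWithin] with z hz
        have h2 : DifferentiableAt ℂ (fun z => (z - 1) * riemannZeta z) z :=
          (by fun_prop : DifferentiableAt ℂ (fun z : ℂ => z - 1) z).mul (analyticAt_riemannZeta hz).differentiableAt
        refine h2.congr_of_eventuallyEq ?_
        filter_upwards [isOpen_compl_singleton.mem_nhds hz] with w hw
        exact Function.update_of_ne hw _ _
      · exact continuousAt_update_same.2 riemannZeta_residue_one
    have h2 : MeromorphicAt (fun z : ℂ => (z - 1)⁻¹ *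
        Function.update (fun z => (z - 1) * riemannZeta z) 1 1 z) 1 :=
      (by fun_prop : MeromorphicAt (fun z : ℂ => (z - 1)⁻¹) 1).mul h1.meromorphicAt
    refine h2.congr ?_
    filter_upwards [self_mem_nhdsWithin] with z hz
    rw [Function.update_of_ne hz, inv_mul_cancel_left₀ (sub_ne_zero.2 hz)]
  · exact (analyticAt_riemannZeta hs).meromorphicAt

theorem analyticAt_apply {ι : Type*} [Fintype ι] (i : ι) (p : ι → ℂ) :
    AnalyticAt ℂ (fun s : ι → ℂ => s i) p :=
  (ContinuousLinearMap.proj (R := ℂ) (φ := fun _ : ι => ℂ) i).analyticAt p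

section tailShift

variable {n : ℕ}

theorem analyticAt_tailShift (c : ℂ) (p : Fin (n + 2) → ℂ) :
    AnalyticAt ℂ (fun s : Fin (n + 2) → ℂ => tailShift s c) p := by
  refine analyticAt_pi_iff.2 fun j => ?_
  simp only [tailShift]
  split_ifs
  · exact (analyticAt_apply _ p).add ((analyticAt_apply _ p).add analyticAt_const)
  · exact (analyticAt_apply _ p).add analyticAt_const

theorem isOpenMap_tailShift (c : ℂ) :
    IsOpenMap (fun s : Fin (n + 2) → ℂ => tailShift s c) := by
  -- A continuous section through `x`: keep its last coordinate and correct the one before.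
  refine IsOpenMap.of_sections fun x => ⟨fun y => Fin.snoc (α := fun _ => ℂ)
    (fun j => y j - if j = Fin.last n then x (Fin.last (n + 1)) + c else 0)
    (x (Fin.last (n + 1))), ?_, ?_, ?_⟩
  · refine Continuous.continuousAt (continuous_pi fun i => ?_)
    induction i using Fin.lastCases with
    | last => simp only [Fin.snoc_last]; fun_prop
    | cast j => simp only [Fin.snoc_castSucc]; fun_prop
  · funext i
    induction i using Fin.lastCases with
    | last => simp
    | cast j => simp [tailShift]
  · intro y
    funext j
    simp [tailShift]

/-- The complement of the hyperplanes `sⱼ + ⋯ + sₙ = 1/dⱼ + ∑_{k > j} εₖ/dₖ - l`. -/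
def regularSet {n : ℕ} (d : Fin n → ℕ) : Set (Fin n → ℂ) :=
  {s | ∀ (j : Fin n) (ε : Fin n → Fin 2) (l : ℕ), ∑ k ∈ Finset.Ici j, s k ≠
    1 / (d j : ℂ) + ∑ k ∈ Finset.Ioi j, ((ε k : ℕ) : ℂ) / d k - l}

variable {d : Fin (n + 2) → ℕ} {s : Fin (n + 2) → ℂ}

/-- The terms `t^k` correspond to `ε = 0` in the last place, with `l` raised by `m`. -/
theorem tailShift_natCast_mem_regularSet (hs : s ∈ regularSet d) (m : ℕ) :
    tailShift s (m : ℂ) ∈ regularSet (Fin.init d : Fin (n + 1) → ℕ) := by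
  intro j ε l h
  refine hs j.castSucc (Fin.snoc (α := fun _ => Fin 2) ε 0) (l + m) ?_
  rw [sum_Ici_tailShift] at h
  rw [Fin.sum_Ioi_castSucc]
  simp only [Fin.snoc_castSucc, Fin.snoc_last, Fin.init] at h ⊢
  push_cast
  simp only [Fin.val_zero, Nat.cast_zero, zero_div]
  linear_combination h

/-- The `t^(-1/d)` term corresponds to `ε = 1` in the last place. -/
theorem tailShift_neg_inv_mem_regularSet (hs : s ∈ regularSet d) :
    tailShift s (-(1 / (d (Fin.last (n + 1)) : ℂ))) ∈
      regularSet (Fin.init d : Fin (n + 1) → ℕ) := by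
  intro j ε l h
  refine hs j.castSucc (Fin.snoc (α := fun _ => Fin 2) ε 1) l ?_
  rw [sum_Ici_tailShift] at h
  rw [Fin.sum_Ioi_castSucc]
  simp only [Fin.snoc_castSucc, Fin.snoc_last, Fin.init] at h ⊢
  simp only [Fin.val_one, Nat.cast_one]
  linear_combination h

end tailShift

/-- On a hyperplane the excluded sum would equal `l - ∑ N k`; being positive, it would be a positive
integer. -/
theorem neg_natCast_mem_regularSet {n : ℕ} {d : Fin n → ℕ} (hd : ∀ j, 0 < d j)
    (hns : NonIntegralSums d) (N : Fin n → ℕ) :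
    (fun j => -(N j : ℂ)) ∈ regularSet d := by
  intro j ε l h
  have h1 : (1 : ℚ) / d j + ∑ k ∈ Finset.Ioi j, ((ε k : ℕ) : ℚ) / d k =
      l - ∑ k ∈ Finset.Ici j, (N k : ℚ) := by
    have h2 : (((1 : ℚ) / d j + ∑ k ∈ Finset.Ioi j, ((ε k : ℕ) : ℚ) / d k : ℚ) : ℂ) =
        ((l - ∑ k ∈ Finset.Ici j, (N k : ℚ) : ℚ) : ℂ) := by
      push_cast
      rw [Finset.sum_neg_distrib] at h
      linear_combination -h
    exact_mod_cast h2
  have h3 : (0 : ℚ) < 1 / d j + ∑ k ∈ Finset.Ioi j, ((ε k : ℕ) : ℚ) / d k := by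
    have := hd j
    positivity
  have h4 : ∑ k ∈ Finset.Ici j, N k < l := by
    rw [h1, sub_pos] at h3
    exact_mod_cast h3
  refine hns j ε (l - ∑ k ∈ Finset.Ici j, N k) (by omega) ?_
  rw [h1]
  push_cast [Nat.cast_sub h4.le]
  rfl

end

/-! ### The induction on the number of variables. -/

noncomputable section

/-- The properties of the continued multiple zeta function carried through the induction on the
number of variables. -/
structure IsRegularContinuation {n : ℕ} (d : Fin (n + 1) → ℕ) (γ : Fin (n + 1) → ℂ)
    (Z : (Fin (n + 1) → ℂ) → ℂ) : Prop where
  hasSum : ∀ s ∈ convergenceDomain d, HasSum (multiZetaTerm d γ s) (Z s)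
  analyticAt : ∀ s ∈ regularSet d, AnalyticAt ℂ Z s
  isQuotientAt : ∀ p, IsQuotientAt Z p
  mem_adjoin : ∀ N : Fin (n + 1) → ℕ,
    Z (fun j => -(N j : ℂ)) ∈ IntermediateField.adjoin ℚ (Set.range γ)
  apply_neg_of_even : (∀ j, j ≠ 0 → Even (d j)) → ∀ N : Fin (n + 1) → ℕ,
    Z (fun j => -(N j : ℂ)) = (-(1 / 2) : ℂ) ^ n * γ 0 ^ (∑ j, N j) * negZeta (d 0) (∑ j, N j)

/-- The factor `x ^ d` is a positive real, so the principal logarithm is additive. -/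
theorem mul_pow_cpow_neg {γ : ℂ} (hγ : γ ≠ 0) {x : ℝ} (hx : 0 < x) (d : ℕ) (s : ℂ) :
    (γ * (x : ℂ) ^ d) ^ (-s) = γ ^ (-s) * (x : ℂ) ^ (-(d * s)) := by
  have hx' : (x : ℂ) ≠ 0 := Complex.ofReal_ne_zero.2 hx.ne'
  have h1 : Complex.log (γ * (x : ℂ) ^ d) = Complex.log γ + d * Complex.log x := by
    rw [mul_comm, ← Complex.ofReal_pow, Complex.log_ofReal_mul (by positivity) hγ, Real.log_pow]
    push_cast
    rw [Complex.ofReal_log hx.le]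
    ring
  rw [Complex.cpow_def_of_ne_zero (mul_ne_zero hγ (pow_ne_zero _ hx')), h1,
    Complex.cpow_def_of_ne_zero hγ, Complex.cpow_def_of_ne_zero hx', ← Complex.exp_add]
  ring_nf

theorem riemannZeta_neg_mul_nat (d k : ℕ) : riemannZeta (d * -(k : ℂ)) = negZeta d k := by
  have := riemannZeta_neg_nat_eq_bernoulli' (d * k)
  rw [show (d * -(k : ℂ)) = -((d * k : ℕ) : ℂ) by simp, this, negZeta]
  push_cast
  rfl

/-- The function is `γ^(-s) ζ(ds)`, whose only possible pole `s = 1/d` is the hyperplane with `l =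
0`. -/
theorem exists_isRegularContinuation_one (d : Fin 1 → ℕ) (hd : ∀ j, 0 < d j) (γ : Fin 1 → ℂ)
    (hγ : ∀ j, 0 < (γ j).re) : ∃ Z, IsRegularContinuation d γ Z := by
  have hγ0 : γ 0 ≠ 0 := fun h => by have := hγ 0; rw [h] at this; simp at this
  have hd0 : (d 0 : ℂ) ≠ 0 := by exact_mod_cast (hd 0).ne'
  have h0 : Finset.Ici (0 : Fin 1) = {0} := rfl
  have h1 : Finset.Ioi (0 : Fin 1) = ∅ := rfl
  have hpow : ∀ p, AnalyticAt ℂ (fun s : Fin 1 → ℂ => γ 0 ^ (-s 0)) p := fun p =>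
    AnalyticAt.cpow analyticAt_const (analyticAt_apply 0 p).neg (Or.inl (hγ 0))
  have hlin : ∀ p, AnalyticAt ℂ (fun s : Fin 1 → ℂ => (d 0 : ℂ) * s 0) p := fun p =>
    analyticAt_const.mul (analyticAt_apply 0 p)
  have hval : ∀ N : Fin 1 → ℕ, γ 0 ^ (-(-(N 0 : ℂ))) * riemannZeta (d 0 * -(N 0 : ℂ)) =
      γ 0 ^ N 0 * negZeta (d 0) (N 0) := fun N => by
    rw [riemannZeta_neg_mul_nat, neg_neg, Complex.cpow_natCast]
  have hterm : ∀ (s : Fin 1 → ℂ) (m : Fin 1 → ℕ+),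
      multiZetaTerm d γ s m = (γ 0 * ((m 0 : ℕ) : ℂ) ^ d 0) ^ (-s 0) := fun s m => by
    have h2 : Finset.Iic (0 : Fin 1) = {0} := rfl
    simp [multiZetaTerm_eq_prod, powerForm, h2]
  refine ⟨fun s => γ 0 ^ (-s 0) * riemannZeta (d 0 * s 0), ?_, ?_, ?_, ?_, ?_⟩
  · intro s hs
    have hs0 := hs 0
    simp only [h0, Finset.sum_singleton] at hs0
    have hs1 : 1 < (d 0 * s 0).re := by
      have : (0 : ℝ) < d 0 := by exact_mod_cast hd 0
      rw [div_lt_iff₀ this] at hs0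
      rw [Complex.mul_re, Complex.natCast_re, Complex.natCast_im]
      linarith
    rw [← (Equiv.funUnique (Fin 1) ℕ+).symm.hasSum_iff, ← Equiv.pnatEquivNat.symm.hasSum_iff,
      zeta_eq_tsum_one_div_nat_add_one_cpow hs1]
    have hsum : Summable fun m : ℕ => 1 / ((m : ℂ) + 1) ^ ((d 0 : ℂ) * s 0) := by
      have := (summable_nat_add_iff 1).2 (Complex.summable_one_div_nat_cpow.2 hs1)
      simpa using this
    refine (hsum.hasSum.mul_left (γ 0 ^ (-s 0))).congr_fun fun m => ?_
    rw [Function.comp_apply, Function.comp_apply, hterm]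
    simp only [Equiv.funUnique_symm_apply, uniqueElim_const, Equiv.pnatEquivNat_symm_apply,
      Nat.succPNat_coe]
    have := mul_pow_cpow_neg hγ0 (x := m + 1) (by positivity) (d 0) (s 0)
    push_cast at this ⊢
    rw [this, Complex.cpow_neg _ ((d 0 : ℂ) * s 0), one_div]
  · intro s hs
    refine (hpow s).mul ((analyticAt_riemannZeta ?_).fun_comp (hlin s))
    intro h
    have := hs 0 0 0
    simp only [h0, h1, Finset.sum_singleton, Finset.sum_empty] at this
    apply this
    rw [← h]
    field_simp
    simp
  · intro p
    refine (IsQuotientAt.of_analyticAt (hpow p)).mul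
      (IsQuotientAt.comp (A := fun s : Fin 1 → ℂ => (d 0 : ℂ) * s 0)
        (IsQuotientAt.of_meromorphicAt (meromorphicAt_riemannZeta _)) (hlin p) ?_)
    exact (Homeomorph.mulLeft₀ (d 0 : ℂ) hd0).isOpenMap.comp (isOpenMap_eval 0)
  · intro N
    change γ 0 ^ (-(-(N 0 : ℂ))) * riemannZeta (d 0 * -(N 0 : ℂ)) ∈ _
    rw [hval]
    exact mul_mem (pow_mem (IntermediateField.subset_adjoin ℚ (Set.range γ) (Set.mem_range_self 0)) _)
      ((IntermediateField.adjoin ℚ (Set.range γ)).algebraMap_mem (negZeta (d 0) (N 0)))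
  · intro _ N
    change γ 0 ^ (-(-(N 0 : ℂ))) * riemannZeta (d 0 * -(N 0 : ℂ)) = _
    rw [hval]
    simp

section step

variable {n : ℕ} (d : Fin (n + 2) → ℕ) (γ : Fin (n + 2) → ℂ) (Z : (Fin (n + 1) → ℂ) → ℂ)

/-- The expansion of order `K` in the last variable, in terms of the function `Z` of one variable
fewer. -/
def lastExpansion (K : ℕ) (s : Fin (n + 2) → ℂ) : ℂ :=
  (Complex.Gamma (s (Fin.last (n + 1))))⁻¹ * (thetaConst (d (Fin.last (n + 1))) (γ (Fin.last (n + 1))) *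
      Complex.Gamma (s (Fin.last (n + 1)) - 1 / d (Fin.last (n + 1)))) *
    Z (tailShift s (-(1 / d (Fin.last (n + 1))))) +
  ∑ k ∈ Finset.range K, (ascPochhammer ℂ k).eval (s (Fin.last (n + 1))) *
    ((negZeta (d (Fin.last (n + 1))) k : ℂ) * ((-γ (Fin.last (n + 1))) ^ k / k.factorial)) *
    Z (tailShift s k) +
  (Complex.Gamma (s (Fin.last (n + 1))))⁻¹ * remainderIntegral d γ K s

variable {d γ Z}

/-- The term gained in the finite sum is exactly what the remainder loses, so the expansions of
different orders glue to one function. -/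
theorem lastExpansion_eq_succ (hd : ∀ j, 0 < d j) (hγ : ∀ j, 0 < (γ j).re)
    (hZ : ∀ s ∈ convergenceDomain (Fin.init d : Fin (n + 1) → ℕ),
      HasSum (multiZetaTerm (Fin.init d) (Fin.init γ) s) (Z s))
    {K : ℕ} {s : Fin (n + 2) → ℂ} (hs : s ∈ remainderDomain d K)
    (hs' : s ∈ remainderDomain d (K + 1)) :
    lastExpansion d γ Z K s = lastExpansion d γ Z (K + 1) s := by
  have h1 := hasSum_remainderIntegral hd hγ hs
  have h2 := hasSum_remainderIntegral hd hγ hs'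
  have h3 := (hZ _ hs.2).mul_left ((negZeta (d (Fin.last (n + 1))) K : ℂ) *
    ((-γ (Fin.last (n + 1))) ^ K / K.factorial) * Complex.Gamma (s (Fin.last (n + 1)) + K))
  have h4 := h1.unique ((h2.add h3).congr_fun fun m => by
    rw [mellinRemainder_eq_succ (hd _) (hγ _)
      (powerForm_re_pos (γ := Fin.init γ) (fun j => hγ _) m _) hs.1,
      multiZetaTerm_tailShift (γ := Fin.init γ) (fun j => hγ _)]
    ring)
  rw [lastExpansion, lastExpansion, h4, Finset.sum_range_succ,
    ← Complex.Gamma_inv_mul_Gamma_add_natCast hs.1]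
  ring

theorem remainderDomain_succ {K : ℕ} {s : Fin (n + 2) → ℂ} (hs : s ∈ remainderDomain d K) :
    s ∈ remainderDomain d (K + 1) := by
  obtain ⟨h1, h2⟩ := hs
  refine ⟨?_, fun j => ?_⟩
  · simp only [Complex.add_re, Complex.natCast_re] at h1 ⊢
    push_cast
    linarith
  · have := h2 j
    rw [sum_Ici_tailShift, Complex.add_re, Complex.natCast_re] at this ⊢
    push_cast
    linarith

theorem lastExpansion_eq_of_le (hd : ∀ j, 0 < d j) (hγ : ∀ j, 0 < (γ j).re)
    (hZ : ∀ s ∈ convergenceDomain (Fin.init d : Fin (n + 1) → ℕ),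
      HasSum (multiZetaTerm (Fin.init d) (Fin.init γ) s) (Z s))
    {K L : ℕ} (hKL : K ≤ L) {s : Fin (n + 2) → ℂ} (hs : s ∈ remainderDomain d K) :
    s ∈ remainderDomain d L ∧ lastExpansion d γ Z K s = lastExpansion d γ Z L s := by
  induction L, hKL using Nat.le_induction with
  | base => exact ⟨hs, rfl⟩
  | succ L _ ih =>
    have h := remainderDomain_succ ih.1
    exact ⟨h, ih.2.trans (lastExpansion_eq_succ hd hγ hZ ih.1 h)⟩

variable (d) in
theorem exists_mem_remainderDomain (s : Fin (n + 2) → ℂ) : ∃ K, s ∈ remainderDomain d K := by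
  have h : ∀ᶠ K : ℕ in atTop, -(s (Fin.last (n + 1))).re < K ∧ ∀ j : Fin (n + 1),
      ∑ k ∈ Finset.Ici j, (1 : ℝ) / (Fin.init d : Fin (n + 1) → ℕ) k -
        (∑ k ∈ Finset.Ici j.castSucc, s k).re < K :=
    ((tendsto_natCast_atTop_atTop (R := ℝ)).eventually_gt_atTop _).and
      (eventually_all.2 fun j => (tendsto_natCast_atTop_atTop (R := ℝ)).eventually_gt_atTop _)
  obtain ⟨K, h1, h2⟩ := h.exists
  refine ⟨K, ?_, fun j => ?_⟩
  · rw [Complex.add_re, Complex.natCast_re]; linarith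
  · rw [sum_Ici_tailShift, Complex.add_re, Complex.natCast_re]; linarith [h2 j]

theorem isOpen_remainderDomain (K : ℕ) : IsOpen (remainderDomain d K) := by
  have : remainderDomain d K = {s : Fin (n + 2) → ℂ | 0 < (s (Fin.last (n + 1)) + K).re} ∩
      ⋂ j : Fin (n + 1), {s : Fin (n + 2) → ℂ | ∑ k ∈ Finset.Ici j, (1 : ℝ) / (Fin.init d : Fin (n + 1) → ℕ) k <
        (∑ k ∈ Finset.Ici j.castSucc, s k + (K : ℂ)).re} := by
    ext s
    simp only [remainderDomain, convergenceDomain, sum_Ici_tailShift, Set.mem_ofPred_eq,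
      Set.mem_inter_iff, Set.mem_iInter]
  rw [this]
  refine IsOpen.inter (isOpen_lt continuous_const (by fun_prop))
    (isOpen_iInter_of_finite fun j => isOpen_lt continuous_const (by fun_prop))

variable (d γ Z) in
/-- The continuation in one variable more, given by the expansion of any sufficiently large order. -/
def lastContinuation (s : Fin (n + 2) → ℂ) : ℂ :=
  lastExpansion d γ Z (exists_mem_remainderDomain d s).choose s

theorem lastContinuation_eq (hd : ∀ j, 0 < d j) (hγ : ∀ j, 0 < (γ j).re)
    (hZ : ∀ s ∈ convergenceDomain (Fin.init d : Fin (n + 1) → ℕ),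
      HasSum (multiZetaTerm (Fin.init d) (Fin.init γ) s) (Z s))
    {K : ℕ} {s : Fin (n + 2) → ℂ} (hs : s ∈ remainderDomain d K) :
    lastContinuation d γ Z s = lastExpansion d γ Z K s := by
  have h := (exists_mem_remainderDomain d s).choose_spec
  rw [lastContinuation]
  rcases le_total (exists_mem_remainderDomain d s).choose K with hK | hK
  · exact (lastExpansion_eq_of_le hd hγ hZ hK h).2
  · exact (lastExpansion_eq_of_le hd hγ hZ hK hs).2.symm

theorem lastContinuation_eventuallyEq (hd : ∀ j, 0 < d j) (hγ : ∀ j, 0 < (γ j).re)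
    (hZ : ∀ s ∈ convergenceDomain (Fin.init d : Fin (n + 1) → ℕ),
      HasSum (multiZetaTerm (Fin.init d) (Fin.init γ) s) (Z s))
    {K : ℕ} {s : Fin (n + 2) → ℂ} (hs : s ∈ remainderDomain d K) :
    lastExpansion d γ Z K =ᶠ[𝓝 s] lastContinuation d γ Z := by
  filter_upwards [(isOpen_remainderDomain K).mem_nhds hs] with x hx
  exact (lastContinuation_eq hd hγ hZ hx).symm

theorem mem_remainderDomain_zero (hd : ∀ j, 0 < d j) {s : Fin (n + 2) → ℂ}
    (hs : s ∈ convergenceDomain d) : s ∈ remainderDomain d 0 ∧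
      1 / (d (Fin.last (n + 1)) : ℝ) < (s (Fin.last (n + 1))).re ∧
      tailShift s (-(1 / (d (Fin.last (n + 1)) : ℂ))) ∈
        convergenceDomain (Fin.init d : Fin (n + 1) → ℕ) := by
  have h0 : 0 < 1 / (d (Fin.last (n + 1)) : ℝ) := by
    have := hd (Fin.last (n + 1)); positivity
  have h1 := hs (Fin.last (n + 1))
  rw [Fin.sum_Ici_last, Fin.sum_Ici_last] at h1
  have h2 : ∀ j : Fin (n + 1), ∑ k ∈ Finset.Ici j, (1 : ℝ) / (Fin.init d : Fin (n + 1) → ℕ) k +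
      1 / (d (Fin.last (n + 1)) : ℝ) < (∑ k ∈ Finset.Ici j.castSucc, s k).re := fun j => by
    have := hs j.castSucc
    rwa [Fin.sum_Ici_castSucc (fun k => (1 : ℝ) / d k)] at this
  have h3 : (-(1 / (d (Fin.last (n + 1)) : ℂ))).re = -(1 / (d (Fin.last (n + 1)) : ℝ)) := by
    rw [show -(1 / (d (Fin.last (n + 1)) : ℂ)) = ((-(1 / (d (Fin.last (n + 1)) : ℝ)) : ℝ) : ℂ) by
      push_cast; rfl, Complex.ofReal_re]
  refine ⟨⟨?_, fun j => ?_⟩, h1, fun j => ?_⟩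
  · simp only [Nat.cast_zero, add_zero]; linarith
  · rw [sum_Ici_tailShift]
    simp only [Nat.cast_zero, add_zero]
    linarith [h2 j]
  · rw [sum_Ici_tailShift, Complex.add_re, h3]
    linarith [h2 j]

/-- On the convergence domain order `0` suffices: the series is summed over the last variable first,
and the result is compared with the expansion term by term. -/
theorem hasSum_lastContinuation (hd : ∀ j, 0 < d j) (hγ : ∀ j, 0 < (γ j).re)
    (hZ : ∀ s ∈ convergenceDomain (Fin.init d : Fin (n + 1) → ℕ),
      HasSum (multiZetaTerm (Fin.init d) (Fin.init γ) s) (Z s))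
    {s : Fin (n + 2) → ℂ} (hs : s ∈ convergenceDomain d) :
    HasSum (multiZetaTerm d γ s) (lastContinuation d γ Z s) := by
  obtain ⟨h0, h1, h2⟩ := mem_remainderDomain_zero hd hs
  have hsum := (summable_multiZetaTerm hd hγ hs).hasSum
  rw [lastContinuation_eq hd hγ hZ h0]
  set e := (Equiv.prodComm _ _).trans (Fin.snocEquiv fun _ : Fin (n + 2) => ℕ+) with he
  have hsum' := e.hasSum_iff.2 hsum
  have hfib := hsum'.prod_fiberwise (g := fun m => multiZetaTerm (Fin.init d) (Fin.init γ)
      (Fin.init s) m * ((Complex.Gamma (s (Fin.last (n + 1))))⁻¹ *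
      (mellinRemainder (d (Fin.last (n + 1))) (γ (Fin.last (n + 1))) 0
        (powerForm (Fin.init d) (Fin.init γ) m (Fin.last n)) (s (Fin.last (n + 1))) +
      thetaConst (d (Fin.last (n + 1))) (γ (Fin.last (n + 1))) *
        (Complex.Gamma (s (Fin.last (n + 1)) - 1 / d (Fin.last (n + 1))) *
          powerForm (Fin.init d) (Fin.init γ) m (Fin.last n) ^
            (-(s (Fin.last (n + 1)) - 1 / d (Fin.last (n + 1)))))))) fun m => by
    refine ((hasSum_add_mul_pow_cpow (hd (Fin.last (n + 1))) (hγ (Fin.last (n + 1)))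
      (powerForm_re_pos (d := Fin.init d) (γ := Fin.init γ) (fun j => hγ _) m (Fin.last n))
      h1).mul_left (multiZetaTerm (Fin.init d) (Fin.init γ) (Fin.init s) m)).congr_fun fun p => ?_
    have hep : e (m, p) = (Fin.snoc m p : Fin (n + 2) → ℕ+) := rfl
    rw [Function.comp_apply, hep, multiZetaTerm_succ, Fin.init_snoc, Fin.snoc_last]
  have h3 := ((hasSum_remainderIntegral hd hγ h0).mul_left
    (Complex.Gamma (s (Fin.last (n + 1))))⁻¹).add ((hZ _ h2).mul_left
      ((Complex.Gamma (s (Fin.last (n + 1))))⁻¹ *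
        (thetaConst (d (Fin.last (n + 1))) (γ (Fin.last (n + 1))) *
        Complex.Gamma (s (Fin.last (n + 1)) - 1 / d (Fin.last (n + 1))))))
  have h4 := hfib.unique (h3.congr_fun fun m => by
    rw [multiZetaTerm_tailShift (γ := Fin.init γ) (fun j => hγ _),
      ← sub_eq_add_neg]
    ring)
  rw [h4] at hsum
  convert hsum using 1
  simp only [lastExpansion, Finset.range_zero, Finset.sum_empty]
  ring

theorem analyticAt_lastContinuation (hd : ∀ j, 0 < d j) (hγ : ∀ j, 0 < (γ j).re)
    (hZ : IsRegularContinuation (Fin.init d : Fin (n + 1) → ℕ) (Fin.init γ) Z)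
    {s : Fin (n + 2) → ℂ} (hs : s ∈ regularSet d) :
    AnalyticAt ℂ (lastContinuation d γ Z) s := by
  obtain ⟨K, hK⟩ := exists_mem_remainderDomain d s
  refine AnalyticAt.congr ?_ (lastContinuation_eventuallyEq hd hγ hZ.hasSum hK)
  have hl := analyticAt_apply (Fin.last (n + 1)) s
  have hΓ : AnalyticAt ℂ (fun s : Fin (n + 2) → ℂ => (Complex.Gamma (s (Fin.last (n + 1))))⁻¹) s :=
    AnalyticAt.fun_comp (g := fun z : ℂ => (Complex.Gamma z)⁻¹)
      (Complex.differentiable_one_div_Gamma.analyticAt _) hl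
  have hΓ' : AnalyticAt ℂ (fun s : Fin (n + 2) → ℂ =>
      Complex.Gamma (s (Fin.last (n + 1)) - 1 / d (Fin.last (n + 1)))) s := by
    have h1 : AnalyticAt ℂ (fun s : Fin (n + 2) → ℂ =>
        (Complex.Gamma (s (Fin.last (n + 1)) - 1 / d (Fin.last (n + 1))))⁻¹) s :=
      AnalyticAt.fun_comp (g := fun z : ℂ => (Complex.Gamma z)⁻¹) (f := fun s : Fin (n + 2) → ℂ =>
          s (Fin.last (n + 1)) - 1 / d (Fin.last (n + 1)))
        (Complex.differentiable_one_div_Gamma.analyticAt _) (hl.sub analyticAt_const)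
    -- The Gamma factor is the inverse of an entire function, nonzero here because `regularSet`
    -- keeps the last coordinate off `1/d - l`.
    have h2 := h1.inv (inv_ne_zero (Complex.Gamma_ne_zero fun l hl => ?_))
    · simpa [Pi.inv_def] using h2
    · refine hs (Fin.last (n + 1)) 0 l ?_
      rw [Fin.sum_Ici_last]
      have : Finset.Ioi (Fin.last (n + 1)) = ∅ := by
        rw [← Fin.top_eq_last]; exact Finset.Ioi_top
      rw [this, Finset.sum_empty]
      linear_combination hl
  refine AnalyticAt.add (AnalyticAt.add ?_ (Finset.analyticAt_fun_sum _ fun k _ => ?_))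
    (hΓ.mul (analyticAt_remainderIntegral hd hγ hK))
  · exact (hΓ.mul (analyticAt_const.mul hΓ')).mul (AnalyticAt.fun_comp
      (hZ.analyticAt _ (tailShift_neg_inv_mem_regularSet hs)) (analyticAt_tailShift _ s))
  · refine AnalyticAt.mul (AnalyticAt.mul ?_ analyticAt_const) (AnalyticAt.fun_comp
      (hZ.analyticAt _ (tailShift_natCast_mem_regularSet hs k)) (analyticAt_tailShift _ s))
    exact AnalyticAt.fun_comp ((ascPochhammer ℂ k).differentiable.analyticAt _) hl

theorem isQuotientAt_lastContinuation (hd : ∀ j, 0 < d j) (hγ : ∀ j, 0 < (γ j).re)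
    (hZ : IsRegularContinuation (Fin.init d : Fin (n + 1) → ℕ) (Fin.init γ) Z)
    (s : Fin (n + 2) → ℂ) : IsQuotientAt (lastContinuation d γ Z) s := by
  obtain ⟨K, hK⟩ := exists_mem_remainderDomain d s
  refine IsQuotientAt.congr ?_ (lastContinuation_eventuallyEq hd hγ hZ.hasSum hK)
  have hl := analyticAt_apply (Fin.last (n + 1)) s
  have hΓ : AnalyticAt ℂ (fun s : Fin (n + 2) → ℂ => (Complex.Gamma (s (Fin.last (n + 1))))⁻¹) s :=
    AnalyticAt.fun_comp (g := fun z : ℂ => (Complex.Gamma z)⁻¹)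
      (Complex.differentiable_one_div_Gamma.analyticAt _) hl
  have hΓ' : IsQuotientAt (fun s : Fin (n + 2) → ℂ =>
      Complex.Gamma (s (Fin.last (n + 1)) - 1 / d (Fin.last (n + 1)))) s :=
    IsQuotientAt.comp (A := fun s : Fin (n + 2) → ℂ =>
        s (Fin.last (n + 1)) - 1 / d (Fin.last (n + 1)))
      (IsQuotientAt.of_meromorphicAt (Meromorphic.Gamma _)) (hl.sub analyticAt_const)
      ((Homeomorph.subRight _).isOpenMap.comp (isOpenMap_eval _))
  have hshift : ∀ c, IsQuotientAt (fun s : Fin (n + 2) → ℂ => Z (tailShift s c)) s := fun c =>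
    IsQuotientAt.comp (hZ.isQuotientAt _) (analyticAt_tailShift c s) (isOpenMap_tailShift c)
  refine IsQuotientAt.add (IsQuotientAt.add ?_ (IsQuotientAt.sum _ fun k _ => ?_))
    (IsQuotientAt.of_analyticAt (hΓ.mul (analyticAt_remainderIntegral hd hγ hK)))
  · exact ((IsQuotientAt.of_analyticAt hΓ).mul
      ((IsQuotientAt.of_analyticAt analyticAt_const).mul hΓ')).mul (hshift _)
  · refine IsQuotientAt.mul (IsQuotientAt.of_analyticAt (AnalyticAt.mul ?_ analyticAt_const))
      (hshift _)
    exact AnalyticAt.fun_comp ((ascPochhammer ℂ k).differentiable.analyticAt _) hl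

/-- Drop the last entry of a tuple of natural numbers, adding it minus `k` to the one before. -/
def tailSub (N : Fin (n + 2) → ℕ) (k : ℕ) : Fin (n + 1) → ℕ :=
  fun j => N j.castSucc + if j = Fin.last n then N (Fin.last (n + 1)) - k else 0

theorem tailShift_neg_natCast {N : Fin (n + 2) → ℕ} {k : ℕ} (hk : k ≤ N (Fin.last (n + 1))) :
    tailShift (fun j => -(N j : ℂ)) (k : ℂ) = fun j => -(tailSub N k j : ℂ) := by
  funext j
  simp only [tailShift, tailSub]
  split_ifs
  · push_cast [Nat.cast_sub hk]; ring
  · simp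

theorem sum_tailSub_zero (N : Fin (n + 2) → ℕ) : ∑ j, tailSub N 0 j = ∑ j, N j := by
  simp [tailSub, Finset.sum_add_distrib, Fin.sum_univ_castSucc (n := n + 1)]

theorem ascPochhammer_eval_neg_natCast_of_lt {k N : ℕ} (h : N < k) :
    (ascPochhammer ℂ k).eval (-(N : ℂ)) = 0 :=
  (ascPochhammer_eval_eq_zero_iff _ _).2 ⟨N, h, by simp⟩

/-- The inverse Gamma factor vanishes at `-N`, removing the first term and the remainder; the
Pochhammer values vanish for `k > N`. -/
theorem lastContinuation_neg_natCast (hd : ∀ j, 0 < d j) (hγ : ∀ j, 0 < (γ j).re)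
    (hZ : IsRegularContinuation (Fin.init d : Fin (n + 1) → ℕ) (Fin.init γ) Z)
    (N : Fin (n + 2) → ℕ) : lastContinuation d γ Z (fun j => -(N j : ℂ)) =
      ∑ k ∈ Finset.range (N (Fin.last (n + 1)) + 1),
        (ascPochhammer ℂ k).eval (-(N (Fin.last (n + 1)) : ℂ)) *
        ((negZeta (d (Fin.last (n + 1))) k : ℂ) * ((-γ (Fin.last (n + 1))) ^ k / k.factorial)) *
        Z (fun j => -(tailSub N k j : ℂ)) := by
  obtain ⟨K, hK⟩ := exists_mem_remainderDomain d fun j => -(N j : ℂ)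
  rw [lastContinuation_eq hd hγ hZ.hasSum hK, lastExpansion, Complex.Gamma_neg_nat_eq_zero]
  simp only [inv_zero, zero_mul, zero_add, add_zero]
  have hNK : N (Fin.last (n + 1)) < K := by
    have := hK.1
    simp only [Complex.add_re, Complex.neg_re, Complex.natCast_re] at this
    exact_mod_cast (by linarith : (N (Fin.last (n + 1)) : ℝ) < K)
  rw [← Finset.sum_subset (Finset.range_subset_range.2 (Nat.succ_le_of_lt hNK))]
  · refine Finset.sum_congr rfl fun k hk => ?_
    rw [tailShift_neg_natCast (Nat.lt_succ_iff.1 (Finset.mem_range.1 hk))]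
  · intro k _ hk
    rw [ascPochhammer_eval_neg_natCast_of_lt (by simpa using hk), zero_mul, zero_mul]

theorem negZeta_eq_zero_of_even {d k : ℕ} (hd : 0 < d) (hd' : Even d) (hk : k ≠ 0) :
    negZeta d k = 0 := by
  have h : 0 < d * k := Nat.mul_pos hd (Nat.pos_of_ne_zero hk)
  rw [negZeta, bernoulli'_eq_zero_of_odd (hd'.mul_right k).add_one (by omega), neg_zero, zero_div]

theorem negZeta_zero (d : ℕ) : negZeta d 0 = -(1 / 2) := by
  simp [negZeta]

theorem isRegularContinuation_lastContinuation (hd : ∀ j, 0 < d j) (hγ : ∀ j, 0 < (γ j).re)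
    (hZ : IsRegularContinuation (Fin.init d : Fin (n + 1) → ℕ) (Fin.init γ) Z) :
    IsRegularContinuation d γ (lastContinuation d γ Z) where
  hasSum _ hs := hasSum_lastContinuation hd hγ hZ.hasSum hs
  analyticAt _ hs := analyticAt_lastContinuation hd hγ hZ hs
  isQuotientAt := isQuotientAt_lastContinuation hd hγ hZ
  mem_adjoin N := by
    set F := IntermediateField.adjoin ℚ (Set.range γ)
    have hF : IntermediateField.adjoin ℚ (Set.range (Fin.init γ : Fin (n + 1) → ℂ)) ≤ F :=
      IntermediateField.adjoin.mono _ _ _ (by rintro _ ⟨j, rfl⟩; exact ⟨j.castSucc, rfl⟩)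
    rw [lastContinuation_neg_natCast hd hγ hZ]
    have hpoch : ∀ k N : ℕ, (ascPochhammer ℂ k).eval (-(N : ℂ)) ∈ F := fun k N => by
      induction k with
      | zero => simp [one_mem]
      | succ k ih =>
        rw [ascPochhammer_succ_eval]
        exact mul_mem ih (add_mem (neg_mem (natCast_mem F _)) (natCast_mem F _))
    refine sum_mem fun k _ => mul_mem (mul_mem (hpoch _ _) (mul_mem (F.algebraMap_mem (negZeta _ k)) ?_))
      (hF (hZ.mem_adjoin _))
    exact div_mem (pow_mem (neg_mem (IntermediateField.subset_adjoin ℚ (Set.range γ)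
      (Set.mem_range_self _))) _) (natCast_mem F _)
  apply_neg_of_even he N := by
    -- The term `k = 0` is split off and supplies the factor `-1/2`; the others vanish because
    -- `ζ(-dk) = 0`.
    rw [lastContinuation_neg_natCast hd hγ hZ, Finset.sum_range_succ',
      Finset.sum_eq_zero fun k _ => ?_]
    · rw [hZ.apply_neg_of_even (fun j hj => he j.castSucc fun h => hj (Fin.castSucc_eq_zero_iff.1 h)),
        sum_tailSub_zero, negZeta_zero]
      simp only [ascPochhammer_zero, Polynomial.eval_one, pow_zero, Nat.factorial_zero, Fin.init,
        Fin.castSucc_zero]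
      push_cast
      ring
    · rw [negZeta_eq_zero_of_even (hd _) (he _ (Fin.last_pos.ne')) (Nat.succ_ne_zero k)]
      simp

end step

theorem exists_isRegularContinuation {n : ℕ} (d : Fin (n + 1) → ℕ) (hd : ∀ j, 0 < d j)
    (γ : Fin (n + 1) → ℂ) (hγ : ∀ j, 0 < (γ j).re) : ∃ Z, IsRegularContinuation d γ Z := by
  induction n with
  | zero => exact exists_isRegularContinuation_one d hd γ hγ
  | succ n ih =>
    obtain ⟨Z, hZ⟩ := ih (Fin.init d) (fun j => hd _) (Fin.init γ) fun j => hγ _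
    exact ⟨_, isRegularContinuation_lastContinuation hd hγ hZ⟩

/-- The sign in the final formula comes from passing between the conventions `B₁ = +1/2` and `B₁ =
-1/2`. -/
theorem negZeta_eq_bernoulli (d k : ℕ) :
    (negZeta d k : ℂ) = (-1 : ℂ) ^ (d * k) * ((bernoulli (d * k + 1) : ℂ) / ((d * k + 1 : ℕ) : ℂ)) := by
  rw [negZeta, bernoulli]
  push_cast
  have h : (-1 : ℂ) ^ (d * k) * (-1) ^ (d * k) = 1 := by rw [← mul_pow]; simp
  rw [pow_succ]
  linear_combination (bernoulli' (d * k + 1) : ℂ) / (d * k + 1) * h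

end
theorem corollary1 (n : ℕ) [NeZero n] (d : Fin n → ℕ) (hd : ∀ j, 0 < d j)
    (γ : Fin n → ℂ) (hγ : ∀ j, 0 < (γ j).re) (hns : NonIntegralSums d) :
    ∃ Z : (Fin n → ℂ) → ℂ, IsMultiZetaContinuation d γ Z ∧
      (∀ N : Fin n → ℕ,
        AnalyticAt ℂ Z (fun j => -(N j : ℂ)) ∧
          Z (fun j => -(N j : ℂ)) ∈ IntermediateField.adjoin ℚ (Set.range γ)) ∧
      ((∀ j, j ≠ 0 → Even (d j)) → ∀ N : Fin n → ℕ,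
        Z (fun j => -(N j : ℂ)) =
          (-(1 / 2) : ℂ) ^ (n - 1) * γ 0 ^ (∑ j, N j) * (-1 : ℂ) ^ (d 0 * ∑ j, N j) *
            ((bernoulli (d 0 * (∑ j, N j) + 1) : ℂ) / ((d 0 * (∑ j, N j) + 1 : ℕ) : ℂ))) ∧
      ((∀ j, Even (d j)) →
        Z 0 = (-(1 / 2) : ℂ) ^ n ∧
          ∀ N : Fin n → ℕ, N ≠ 0 → Z (fun j => -(N j : ℂ)) = 0) := by
  obtain ⟨n, rfl⟩ := Nat.exists_eq_succ_of_ne_zero (NeZero.ne n)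
  obtain ⟨Z, hZ⟩ := exists_isRegularContinuation d hd γ hγ
  refine ⟨Z, ⟨IsQuotientAt.isMeromorphicOnSpace hZ.isQuotientAt, hZ.hasSum⟩,
    fun N => ⟨hZ.analyticAt _ (neg_natCast_mem_regularSet hd hns N), hZ.mem_adjoin N⟩,
    fun he N => ?_, fun he => ⟨?_, fun N hN => ?_⟩⟩
  · rw [hZ.apply_neg_of_even he, negZeta_eq_bernoulli, ← mul_assoc]
    rfl
  -- At `N = 0` the factor `ζ(0) = -1/2` of the first variable supplies the last of the powers of
  -- `-1/2`.
  · have h := hZ.apply_neg_of_even (fun j _ => he j) 0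
    have h0 : (fun j : Fin (n + 1) => -(((0 : Fin (n + 1) → ℕ) j : ℕ) : ℂ)) = 0 := by
      funext j; simp
    rw [h0] at h
    rw [h]
    simp only [Pi.zero_apply, Finset.sum_const_zero, pow_zero, negZeta_zero]
    push_cast
    rw [mul_one, pow_succ]
  · have hs : ∑ j, N j ≠ 0 := fun h => hN <| by
      funext j
      exact (Finset.sum_eq_zero_iff.1 h) j (Finset.mem_univ j)
    rw [hZ.apply_neg_of_even (fun j _ => he j), negZeta_eq_zero_of_even (hd 0) (he 0) hs]
    simp
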